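/- Let $n>1$, let $D\subset\mathbb C^n$ be a domain (not necessarily bounded) with $C^2$-smooth boundary, let $\xi\in\partial D$, and let $\nu_\zeta$ denote the unit outward normal to $\partial D$ at $\zeta\in\partial D$. Write $(z,w)=\sum_j z_j\overline{w_j}$, let $T_\xi=\{w:\operatorname{Re}(w-\xi,\nu_\xi)=0\}$ be the real tangent plane at $\xi$, and put $$d(z)=\min\{\operatorname{dist}(z,\partial D),\operatorname{dist}(z,T_\xi)\}.$$ For $\alpha>0$ the admissible domain with vertex $\xi$ and aperture $\alpha$ is $$\mathcal A_\alpha(\xi)=\{z\in D:\ \operatorname{Re}(z-\xi,\nu_\xi)<0,\ |(z-\xi,\nu_\xi)|<(1+\alpha)d(z),\ |z-\xi|^2<\alpha d(z)\}.$$ Let $f$ be holomorphic in $D$ and suppose that $f$ has a limit along the normal at $\xi$, i.e. $\lim_{t\to0+}f(\xi-t\nu_\xi)$ exists in $\overline{\mathbb C}=\mathbb C\cup\{\infty\}$. Then $f$ has an admissible limit at $\xi$ (there is $L\in\overline{\mathbb C}$ such that, for every $\alpha>0$, $f(z)\to L$ as $z\to\xi$, $z\in\mathcal A_\alpha(\xi)$)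 if and only if for every $\alpha>0$, as $z\to\xi$ in $\mathcal A_\alpha(\xi)$, $$\frac{|df_z(\nu_{\zeta(z)})|}{1+|f(z)|^2}=o\Big(\frac1{d(z)}\Big)\quad\text{and}\quad \sup_{v}\frac{|df_z(v)|}{1+|f(z)|^2}=o\Big(\frac1{\sqrt{d(z)}}\Big),$$ where $\zeta(z)$ is the point of $\partial D$ closest to $z$, $df_z(v)=\sum_j\frac{\partial f}{\partial z_j}(z)\,v_j$, and the supremum is over the unit vectors $v$ of the complex tangent space $\{v:(v,\nu_{\zeta(z)})=0\}$ of $\partial D$ at $\zeta(z)$. -/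

import Mathlib

open Filter Topology

/-- A `C²` local defining function `ρ` of the set `D` on an open neighbourhood `U` of `p`:
`D` is `{ρ < 0}` in `U`, and `dρ` has no zeros in `U`. -/
structure IsLocalDefiningFunction {n : ℕ} (D : Set (EuclideanSpace ℂ (Fin n)))
    (p : EuclideanSpace ℂ (Fin n)) (U : Set (EuclideanSpace ℂ (Fin n)))
    (ρ : EuclideanSpace ℂ (Fin n) → ℝ) : Prop where
  isOpen : IsOpen U
  mem : p ∈ U
  contDiffOn : ContDiffOn ℝ 2 ρ U
  fderiv_ne_zero : ∀ x ∈ U, fderiv ℝ ρ x ≠ 0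
  inter_eq : D ∩ U = {x ∈ U | ρ x < 0}

/-- `D` has `C²`-smooth boundary. -/
def HasC2Boundary {n : ℕ} (D : Set (EuclideanSpace ℂ (Fin n))) : Prop :=
  ∀ p ∈ frontier D, ∃ U ρ, IsLocalDefiningFunction D p U ρ

/-- `ν` is the unit outward normal to `∂D` at the boundary point `ξ`: it is the positive multiple
of norm one of the (real) gradient at `ξ` of a local defining function. The real part of the
Hermitian product is the Euclidean inner product of `ℂⁿ = ℝ²ⁿ`. -/
def IsUnitOutwardNormal {n : ℕ} (D : Set (EuclideanSpace ℂ (Fin n)))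
    (ξ ν : EuclideanSpace ℂ (Fin n)) : Prop :=
  ‖ν‖ = 1 ∧ ∃ U ρ, IsLocalDefiningFunction D ξ U ρ ∧
    ∃ c : ℝ, 0 < c ∧ ∀ v, fderiv ℝ ρ ξ v = c * (inner ℂ ν v).re

/-- The real tangent plane at `ξ` of a hypersurface with unit normal `ν` at `ξ`. -/
def realTangentPlane {n : ℕ} (ξ ν : EuclideanSpace ℂ (Fin n)) :
    Set (EuclideanSpace ℂ (Fin n)) :=
  {w | (inner ℂ ν (w - ξ)).re = 0}

/-- `δ_ξ(z)`: the minimum of the distances of `z` from the boundary of `D` and from the real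
tangent plane at `ξ`, where `ν` is the unit normal at `ξ`. -/
noncomputable def vertexDist {n : ℕ} (D : Set (EuclideanSpace ℂ (Fin n)))
    (ξ ν z : EuclideanSpace ℂ (Fin n)) : ℝ :=
  min (Metric.infDist z (frontier D)) (Metric.infDist z (realTangentPlane ξ ν))

/-- The admissible approach domain with vertex `ξ` and aperture `α`; `ν` is the unit outward
normal at `ξ`. It lies on the inner side of the real tangent plane at `ξ`. -/
def admissibleDomain {n : ℕ} (D : Set (EuclideanSpace ℂ (Fin n)))
    (ξ ν : EuclideanSpace ℂ (Fin n)) (α : ℝ) : Set (EuclideanSpace ℂ (Fin n)) :=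
  {z ∈ D | (inner ℂ ν (z - ξ)).re < 0 ∧
    ‖inner ℂ ν (z - ξ)‖ < (1 + α) * vertexDist D ξ ν z ∧
    ‖z - ξ‖ ^ 2 < α * vertexDist D ξ ν z}

/-- `f` has the limit `L` (a point of the Riemann sphere) at `ξ` along the normal `ν`. -/
def HasNormalLimit {n : ℕ} (f : EuclideanSpace ℂ (Fin n) → ℂ)
    (ξ ν : EuclideanSpace ℂ (Fin n)) (L : OnePoint ℂ) : Prop :=
  Tendsto (fun t : ℝ => (f (ξ - t • ν) : OnePoint ℂ)) (𝓝[>] 0) (𝓝 L)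

/-- `f` has the admissible limit `L` (a point of the Riemann sphere) at `ξ`. -/
def HasAdmissibleLimit {n : ℕ} (D : Set (EuclideanSpace ℂ (Fin n)))
    (f : EuclideanSpace ℂ (Fin n) → ℂ) (ξ ν : EuclideanSpace ℂ (Fin n))
    (L : OnePoint ℂ) : Prop :=
  ∀ α : ℝ, 0 < α →
    Tendsto (fun z => (f z : OnePoint ℂ)) (𝓝[admissibleDomain D ξ ν α] ξ) (𝓝 L)

/-- The spherical derivative of `f` at `z` in the complex direction of the vector `v`. -/
noncomputable def sphericalDeriv {n : ℕ} (f : EuclideanSpace ℂ (Fin n) → ℂ)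
    (z v : EuclideanSpace ℂ (Fin n)) : ℝ :=
  ‖fderiv ℂ f z v‖ / (1 + ‖f z‖ ^ 2)

/-- `ζ` is a point of the boundary of `D` closest to `z`. -/
def IsClosestBoundaryPoint {n : ℕ} (D : Set (EuclideanSpace ℂ (Fin n)))
    (z ζ : EuclideanSpace ℂ (Fin n)) : Prop :=
  ζ ∈ frontier D ∧ dist z ζ = Metric.infDist z (frontier D)

/-- As `z → ξ` in the admissible domain of aperture `α`, the spherical derivative of `f` in the
complex normal direction is `o(1 / δ_ξ(z))`. The direction at `z` is that of the normal `η` at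
the boundary point `ζ` closest to `z`. -/
def NormalSphericalDerivLittleO {n : ℕ} (D : Set (EuclideanSpace ℂ (Fin n)))
    (f : EuclideanSpace ℂ (Fin n) → ℂ) (ξ ν : EuclideanSpace ℂ (Fin n)) (α : ℝ) : Prop :=
  ∀ ε : ℝ, 0 < ε → ∀ᶠ z in 𝓝[admissibleDomain D ξ ν α] ξ,
    ∀ ζ η, IsClosestBoundaryPoint D z ζ → IsUnitOutwardNormal D ζ η →
      sphericalDeriv f z η ≤ ε * (1 / vertexDist D ξ ν z)

/-- As `z → ξ` in the admissible domain of aperture `α`, the spherical derivative of `f` in the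
complex tangential directions is `o(1 / √δ_ξ(z))`. The directions at `z` are those of the unit
vectors of the complex tangent space (the Hermitian complement of the normal `η`) at the boundary
point `ζ` closest to `z`. -/
def TangentialSphericalDerivLittleO {n : ℕ} (D : Set (EuclideanSpace ℂ (Fin n)))
    (f : EuclideanSpace ℂ (Fin n) → ℂ) (ξ ν : EuclideanSpace ℂ (Fin n)) (α : ℝ) : Prop :=
  ∀ ε : ℝ, 0 < ε → ∀ᶠ z in 𝓝[admissibleDomain D ξ ν α] ξ,
    ∀ ζ η, IsClosestBoundaryPoint D z ζ → IsUnitOutwardNormal D ζ η →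
      ∀ v, ‖v‖ = 1 → inner ℂ η v = 0 →
        sphericalDeriv f z v ≤ ε * (1 / √(vertexDist D ξ ν z))

/-! Write `d` for `vertexDist` at `z`. Near `ξ` an admissible domain has room of order `d` around
`z` in the complex normal direction and of order `√d` in the complex tangential ones, at the price
of a larger aperture (`add_mem_admissibleDomain`).

If `f` has an admissible limit `L`, Cauchy's estimate for `f`, or for `1/f` when `L = ∞`, on discs
of these radii bounds the spherical derivative by `ε / R`; these are the two derivative conditions.

Conversely, join `z` to the point of the normal with the same value of `Re (z - ξ, ν)`. The segment
has length `O(√d)`, and its direction has complex normal part `O(d)`. By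
`segment_mem_admissibleDomain` it stays in a larger admissible domain, at depth at least `d / 8`:
along it a defining function is, up to a fraction of `d`, a convex combination of its value at `z`
and the height `Re (z - ξ, ν)`, both negative of order `d`. This is where `C²` and the distance from
the tangent plane enter. The derivative conditions then make the spherical length of the image of
the segment `o(1)`, so `f` has its normal limit in the whole admissible domain.

The normal at the closest boundary point differs from `ν` by `O(√d)` (`norm_normal_sub_le`). On a
vector of length `O(√d)` this changes the normal part only by `O(d)`, so either normal may be used.
-/

/-! ### Real inner product and real tangent plane. -/

section RealInner

variable {n : ℕ}

/-- The Euclidean inner product with `ν` on `ℂⁿ = ℝ²ⁿ`. -/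
noncomputable def reInner (ν : EuclideanSpace ℂ (Fin n)) : EuclideanSpace ℂ (Fin n) →L[ℝ] ℝ :=
  Complex.reCLM.comp ((innerSL ℂ ν).restrictScalars ℝ)

@[simp]
theorem reInner_apply (ν v : EuclideanSpace ℂ (Fin n)) : reInner ν v = (inner ℂ ν v).re := rfl

theorem abs_re_inner_le (ν v : EuclideanSpace ℂ (Fin n)) : |(inner ℂ ν v).re| ≤ ‖ν‖ * ‖v‖ :=
  (Complex.abs_re_le_norm _).trans (norm_inner_le_norm _ _)

theorem re_inner_self (v : EuclideanSpace ℂ (Fin n)) : (inner ℂ v v).re = ‖v‖ ^ 2 :=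
  inner_self_eq_norm_sq (𝕜 := ℂ) v

theorem re_inner_comm (v w : EuclideanSpace ℂ (Fin n)) :
    (inner ℂ v w).re = (inner ℂ w v).re :=
  inner_re_symm (𝕜 := ℂ) v w

theorem exists_eq_reInner (φ : EuclideanSpace ℂ (Fin n) →L[ℝ] ℝ) :
    ∃ g, ∀ v, φ v = (inner ℂ g v).re := by
  refine ⟨(InnerProductSpace.toDual ℂ _).symm (StrongDual.extendRCLike (𝕜 := ℂ) φ), fun v => ?_⟩
  rw [InnerProductSpace.toDual_symm_apply, StrongDual.extendRCLike_apply]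
  simp

theorem norm_le_of_re_inner_le {g : EuclideanSpace ℂ (Fin n)} {K : ℝ} (hK : 0 ≤ K)
    (h : ∀ v, (inner ℂ g v).re ≤ K * ‖v‖) : ‖g‖ ≤ K := by
  have := h g
  rw [re_inner_self] at this
  by_contra! hlt
  have hg : 0 < ‖g‖ := hK.trans_lt hlt
  nlinarith

/-- Unit vectors that define half-spaces such that one lies in the other coincide. -/
theorem eq_of_re_inner_nonpos {η η' : EuclideanSpace ℂ (Fin n)} (h1 : ‖η‖ = 1) (h1' : ‖η'‖ = 1)
    (h : ∀ w, (inner ℂ η w).re < 0 → (inner ℂ η' w).re ≤ 0) : η = η' := by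
  by_contra hne
  have hpos : 0 < ‖η' - η‖ ^ 2 := by
    have := norm_pos_iff.2 (sub_ne_zero.2 (Ne.symm hne))
    positivity
  have hexp : ‖η' - η‖ ^ 2 = 2 - 2 * (inner ℂ η η').re := by
    rw [← re_inner_self]
    simp only [inner_sub_left, inner_sub_right, Complex.sub_re, re_inner_self, h1, h1']
    rw [re_inner_comm η' η]
    ring
  -- The test vector `η' - η` has real inner product `-‖η' - η‖² / 2` with `η` and `+‖η' - η‖² / 2`
  -- with `η'`.
  have := h (η' - η) (by
    simp only [inner_sub_right, Complex.sub_re, re_inner_self, h1]; linarith)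
  simp only [inner_sub_right, Complex.sub_re, re_inner_self, h1', re_inner_comm η' η] at this
  linarith

/-- The distance from the real tangent plane. -/
theorem infDist_realTangentPlane {ξ ν : EuclideanSpace ℂ (Fin n)} (hν : ‖ν‖ = 1)
    (z : EuclideanSpace ℂ (Fin n)) :
    Metric.infDist z (realTangentPlane ξ ν) = |(inner ℂ ν (z - ξ)).re| := by
  have hξ : ξ ∈ realTangentPlane ξ ν := by simp [realTangentPlane]
  apply le_antisymm
  · set a : ℝ := (inner ℂ ν (z - ξ)).re with ha
    have hmem : z - a • ν ∈ realTangentPlane ξ ν := by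
      have : z - a • ν - ξ = (z - ξ) - a • ν := by abel
      have h2 : (inner ℂ ν (a • ν)).re = a := by
        rw [← reInner_apply, map_smul, reInner_apply, re_inner_self, hν]; simp
      change (inner ℂ ν (z - a • ν - ξ)).re = 0
      rw [this, inner_sub_right, Complex.sub_re, h2]
      exact sub_self _
    refine (Metric.infDist_le_dist_of_mem hmem).trans ?_
    rw [dist_eq_norm, sub_sub_cancel, norm_smul, hν, Real.norm_eq_abs, mul_one]
  · refine (Metric.le_infDist ⟨ξ, hξ⟩).2 fun w hw => ?_
    have hw' : (inner ℂ ν (w - ξ)).re = 0 := hw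
    have : (inner ℂ ν (z - ξ)).re = (inner ℂ ν (z - w)).re := by
      rw [← sub_add_sub_cancel z w ξ, inner_add_right, Complex.add_re, hw', add_zero]
    rw [this, dist_eq_norm]
    simpa [hν] using abs_re_inner_le ν (z - w)

end RealInner

/-- Off its frontier the space splits into two disjoint open sets, the interior and the exterior of
`t`. This will put the ball about `z` of radius the boundary distance inside `D`. -/
theorem IsPreconnected.subset_of_disjoint_frontier {X : Type*} [TopologicalSpace X] {s t : Set X}
    (hs : IsPreconnected s) (hst : (s ∩ t).Nonempty) (h : Disjoint s (frontier t)) : s ⊆ t := by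
  have hsub : s ⊆ interior t ∪ (closure t)ᶜ := by
    intro x hx
    by_cases hi : x ∈ interior t
    · exact Or.inl hi
    · exact Or.inr fun hc => Set.disjoint_left.1 h hx ⟨hc, hi⟩
  have hdis : Disjoint (interior t) (closure t)ᶜ :=
    Set.disjoint_compl_right_iff_subset.2 (interior_subset.trans subset_closure)
  obtain ⟨x, hxs, hxt⟩ := hst
  refine (hs.subset_left_of_subset_union isOpen_interior isClosed_closure.isOpen_compl hdis hsub
    ⟨x, hxs, ?_⟩).trans interior_subset
  exact (hsub hxs).resolve_right fun hc => hc (subset_closure hxt)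

/-! ### Defining functions and uniqueness of the outward normal. -/

section DefiningFunction

variable {n : ℕ} {D U : Set (EuclideanSpace ℂ (Fin n))} {p q ξ η ν : EuclideanSpace ℂ (Fin n)}
  {ρ : EuclideanSpace ℂ (Fin n) → ℝ}

namespace IsLocalDefiningFunction

theorem of_mem (h : IsLocalDefiningFunction D p U ρ) (hq : q ∈ U) :
    IsLocalDefiningFunction D q U ρ :=
  ⟨h.isOpen, hq, h.contDiffOn, h.fderiv_ne_zero, h.inter_eq⟩

theorem contDiffAt (h : IsLocalDefiningFunction D p U ρ) (hq : q ∈ U) : ContDiffAt ℝ 2 ρ q :=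
  h.contDiffOn.contDiffAt (h.isOpen.mem_nhds hq)

theorem differentiableAt (h : IsLocalDefiningFunction D p U ρ) (hq : q ∈ U) :
    DifferentiableAt ℝ ρ q :=
  (h.contDiffAt hq).differentiableAt (by norm_num)

theorem mem_iff (h : IsLocalDefiningFunction D p U ρ) (hq : q ∈ U) : q ∈ D ↔ ρ q < 0 := by
  have := Set.ext_iff.1 h.inter_eq q
  simpa [hq] using this

/-- A positive value would keep `D` away from `q`; a negative one would put `q` in `D`, which is
open and so misses its frontier. -/
theorem eq_zero_of_mem_frontier (h : IsLocalDefiningFunction D p U ρ) (hD : IsOpen D)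
    (hq : q ∈ U) (hqf : q ∈ frontier D) : ρ q = 0 := by
  apply le_antisymm
  · by_contra! hlt
    have hcont := (h.differentiableAt hq).continuousAt
    have hev : ∀ᶠ x in 𝓝 q, 0 < ρ x ∧ x ∈ U :=
      (hcont.eventually (lt_mem_nhds hlt)).and (h.isOpen.mem_nhds hq)
    obtain ⟨x, hx, hxD⟩ := (mem_closure_iff_frequently.1 hqf.1).and_eventually hev |>.exists
    exact absurd ((h.mem_iff hxD.2).1 hx) hxD.1.not_gt
  · by_contra! hlt
    exact hqf.2 (hD.interior_eq.symm ▸ (h.mem_iff hq).2 hlt)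

theorem exists_smul_eq (h : IsLocalDefiningFunction D p U ρ) :
    ∃ η, ‖η‖ = 1 ∧ ∃ c : ℝ, 0 < c ∧ ∀ v, fderiv ℝ ρ p v = c * (inner ℂ η v).re := by
  obtain ⟨g, hg⟩ := exists_eq_reInner (fderiv ℝ ρ p)
  have hg0 : g ≠ 0 := by
    rintro rfl
    exact h.fderiv_ne_zero p h.mem (by ext v; simp [hg])
  have hn : ‖g‖ ≠ 0 := norm_ne_zero_iff.2 hg0
  refine ⟨(‖g‖⁻¹ : ℂ) • g, ?_, ‖g‖, by positivity, fun v => ?_⟩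
  · rw [norm_smul]; simp [hn]
  · rw [hg, inner_smul_left, ← Complex.ofReal_inv, Complex.conj_ofReal, Complex.re_ofReal_mul,
      mul_inv_cancel_left₀ hn]

theorem exists_isUnitOutwardNormal (h : IsLocalDefiningFunction D p U ρ) :
    ∃ η, IsUnitOutwardNormal D p η := by
  obtain ⟨η, h1, c, hc, hη⟩ := h.exists_smul_eq
  exact ⟨η, h1, U, ρ, h, c, hc, hη⟩

/-- The derivative of one defining function is nonpositive in directions that point inwards
according to another one. -/
theorem fderiv_nonpos {U' : Set (EuclideanSpace ℂ (Fin n))} {ρ' : EuclideanSpace ℂ (Fin n) → ℝ}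
    (h : IsLocalDefiningFunction D p U ρ) (h' : IsLocalDefiningFunction D p U' ρ')
    (hD : IsOpen D) (hp : p ∈ frontier D) {w : EuclideanSpace ℂ (Fin n)}
    (hw : fderiv ℝ ρ p w < 0) : fderiv ℝ ρ' p w ≤ 0 := by
  have hline : HasDerivAt (fun t : ℝ => p + t • w) w 0 := by
    simpa using ((hasDerivAt_id (0 : ℝ)).smul_const w).const_add p
  have key : ∀ {U ρ}, IsLocalDefiningFunction D p U ρ →
      HasDerivAt (fun t : ℝ => ρ (p + t • w)) (fderiv ℝ ρ p w) 0 := by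
    intro U ρ h
    refine HasFDerivAt.comp_hasDerivAt (x := (0 : ℝ)) (f := fun t : ℝ => p + t • w) ?_ hline
    simpa using (h.differentiableAt h.mem).hasFDerivAt
  have hU : ∀ {U ρ}, IsLocalDefiningFunction D p U ρ → ∀ᶠ t : ℝ in 𝓝 0, p + t • w ∈ U := by
    intro U ρ h
    refine hline.continuousAt.eventually_mem (h.isOpen.mem_nhds ?_)
    simpa using h.mem
  -- Otherwise, for small `t > 0`, the point `p + t • w` has `ρ < 0` and `ρ' > 0`, hence is both in
  -- `D` and outside it.
  by_contra! hpos
  have hk := hasDerivAt_iff_tendsto_slope_zero.1 (key h)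
  have hk' := hasDerivAt_iff_tendsto_slope_zero.1 (key h')
  have hlt := hk.eventually (gt_mem_nhds hw)
  have hgt := hk'.eventually (lt_mem_nhds hpos)
  have hlt' := hlt.filter_mono (nhdsWithin_mono (0 : ℝ) (s := Set.Ioi 0) fun x hx => ne_of_gt hx)
  have hgt' := hgt.filter_mono (nhdsWithin_mono (0 : ℝ) (s := Set.Ioi 0) fun x hx => ne_of_gt hx)
  obtain ⟨t, ⟨⟨⟨h1, h2⟩, h3⟩, h4⟩, h5⟩ := ((((hlt'.and hgt').and
    ((hU h).filter_mono nhdsWithin_le_nhds)).and ((hU h').filter_mono nhdsWithin_le_nhds)).and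
    (self_mem_nhdsWithin (s := Set.Ioi (0 : ℝ)))).exists
  simp only [zero_add, zero_smul, add_zero, h.eq_zero_of_mem_frontier hD h.mem hp,
    h'.eq_zero_of_mem_frontier hD h'.mem hp, sub_zero, smul_eq_mul] at h1 h2
  have ht : 0 < t⁻¹ := inv_pos.2 h5
  have h6 : ρ (p + t • w) < 0 := by
    by_contra! hh
    exact absurd h1 (mul_nonneg ht.le hh).not_gt
  have h7 := (h'.mem_iff h4).1 ((h.mem_iff h3).2 h6)
  exact absurd h2 (mul_neg_of_pos_of_neg ht h7).not_gt

end IsLocalDefiningFunction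

theorem IsUnitOutwardNormal.unique {η' : EuclideanSpace ℂ (Fin n)} (hD : IsOpen D)
    (hp : p ∈ frontier D) (h : IsUnitOutwardNormal D p η) (h' : IsUnitOutwardNormal D p η') :
    η = η' := by
  obtain ⟨h1, U, ρ, hρ, c, hc, hη⟩ := h
  obtain ⟨h1', U', ρ', hρ', c', hc', hη'⟩ := h'
  refine eq_of_re_inner_nonpos h1 h1' fun w hw => ?_
  have := hρ.fderiv_nonpos hρ' hD hp (w := w) (by rw [hη]; exact mul_neg_of_pos_of_neg hc hw)
  rw [hη'] at this
  by_contra! hh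
  exact absurd this (mul_pos hc' hh).not_ge

end DefiningFunction

/-! ### Normalized charts: Taylor expansion, boundary distance, variation of the normal. -/

section BoundaryChart

variable {n : ℕ}

/-- A `C²` defining function `ρ` of `D` on the ball of radius `r` about `ξ`, normalized so that its
gradient at `ξ` is `ν`, with second derivative `B` at `ξ`, and with a derivative that varies
little. -/
structure IsBoundaryChart (D : Set (EuclideanSpace ℂ (Fin n))) (ξ ν : EuclideanSpace ℂ (Fin n))
    (ρ : EuclideanSpace ℂ (Fin n) → ℝ) (r C : ℝ)
    (B : EuclideanSpace ℂ (Fin n) →L[ℝ] EuclideanSpace ℂ (Fin n) →L[ℝ] ℝ) : Prop where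
  defining : IsLocalDefiningFunction D ξ (Metric.ball ξ r) ρ
  isOpen : IsOpen D
  mem_frontier : ξ ∈ frontier D
  pos : 0 < r
  nonneg : 0 ≤ C
  norm_eq : ‖ν‖ = 1
  norm_fderiv_sub_le : ∀ y ∈ Metric.ball ξ r, ‖fderiv ℝ ρ y - reInner ν‖ ≤ C * ‖y - ξ‖
  norm_fderiv_sub_le_half : ∀ y ∈ Metric.ball ξ r, ‖fderiv ℝ ρ y - reInner ν‖ ≤ 1 / 2
  taylor : ∀ ε : ℝ, 0 < ε → ∃ δ > 0, ∀ x ∈ Metric.ball ξ δ,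
    |ρ x - (inner ℂ ν (x - ξ)).re - B (x - ξ) (x - ξ) / 2| ≤ ε * ‖x - ξ‖ ^ 2

/-- Second-order Taylor expansion, from the second derivative at a point. -/
theorem taylor_two_of_hasFDerivAt_fderiv {E : Type*} [NormedAddCommGroup E] [NormedSpace ℝ E]
    {ρ : E → ℝ} {ξ : E} {B : E →L[ℝ] E →L[ℝ] ℝ} (hdiff : ∀ᶠ x in 𝓝 ξ, DifferentiableAt ℝ ρ x)
    (hB : HasFDerivAt (fderiv ℝ ρ) B ξ) {ε : ℝ} (hε : 0 < ε) :
    ∃ δ > 0, ∀ x ∈ Metric.ball ξ δ,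
      |ρ x - ρ ξ - fderiv ℝ ρ ξ (x - ξ) - B (x - ξ) (x - ξ) / 2| ≤ ε * ‖x - ξ‖ ^ 2 := by
  obtain ⟨δ, hδ, hball⟩ := Metric.eventually_nhds_iff_ball.1
    (hdiff.and (hB.isLittleO.def hε))
  refine ⟨δ, hδ, fun x hx => ?_⟩
  set v := x - ξ with hv
  have hmem : ∀ t ∈ Set.Icc (0 : ℝ) 1, ξ + t • v ∈ Metric.ball ξ δ := by
    intro t ht
    rw [mem_ball_iff_norm] at hx ⊢
    rw [add_sub_cancel_left, norm_smul, Real.norm_of_nonneg ht.1]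
    exact (mul_le_of_le_one_left (norm_nonneg _) ht.2).trans_lt hx
  -- With the linear and quadratic terms subtracted along the segment, the remaining derivative is
  -- at most `ε ‖v‖²`, by differentiability of `fderiv ℝ ρ` at `ξ`.
  have hder : ∀ t ∈ Set.Icc (0 : ℝ) 1, HasDerivWithinAt
      (fun t : ℝ => ρ (ξ + t • v) - t * fderiv ℝ ρ ξ v - t ^ 2 * (B v v / 2))
      (fderiv ℝ ρ (ξ + t • v) v - fderiv ℝ ρ ξ v - t * B v v) (Set.Icc 0 1) t := by
    intro t ht
    have hline : HasDerivAt (fun t : ℝ => ξ + t • v) v t := by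
      simpa using ((hasDerivAt_id t).smul_const v).const_add ξ
    have h1 := (hball _ (hmem t ht)).1.hasFDerivAt.comp_hasDerivAt t hline
    have h2 := (h1.sub ((hasDerivAt_id t).mul_const (fderiv ℝ ρ ξ v))).sub
      ((hasDerivAt_pow 2 t).mul_const (B v v / 2))
    refine (h2.congr_deriv ?_).hasDerivWithinAt
    simp
    ring
  have hbound : ∀ t ∈ Set.Ico (0 : ℝ) 1,
      ‖fderiv ℝ ρ (ξ + t • v) v - fderiv ℝ ρ ξ v - t * B v v‖ ≤ ε * ‖v‖ ^ 2 := by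
    intro t ht
    have h1 := (hball _ (hmem t ⟨ht.1, ht.2.le⟩)).2
    rw [add_sub_cancel_left] at h1
    have h2 := (fderiv ℝ ρ (ξ + t • v) - fderiv ℝ ρ ξ - B (t • v)).le_opNorm v
    have h3 : (fderiv ℝ ρ (ξ + t • v) - fderiv ℝ ρ ξ - B (t • v)) v =
        fderiv ℝ ρ (ξ + t • v) v - fderiv ℝ ρ ξ v - t * B v v := by simp
    rw [h3] at h2
    refine h2.trans ((mul_le_mul_of_nonneg_right h1 (norm_nonneg v)).trans ?_)
    rw [norm_smul, Real.norm_of_nonneg ht.1]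
    calc ε * (t * ‖v‖) * ‖v‖ = t * (ε * ‖v‖ ^ 2) := by ring
      _ ≤ ε * ‖v‖ ^ 2 := mul_le_of_le_one_left (by positivity) ht.2.le
  have := norm_image_sub_le_of_norm_deriv_le_segment_01' hder hbound
  rw [Real.norm_eq_abs] at this
  convert this using 2
  simp [hv]
  ring

variable {D : Set (EuclideanSpace ℂ (Fin n))} {ξ ν : EuclideanSpace ℂ (Fin n)}

/-- Dividing a defining function by `c` makes its gradient at `ξ` equal to `ν`. Differentiability of
the gradient at the single point `ξ` then yields both the linear bound with `C` and the Taylor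
expansion. -/
theorem IsUnitOutwardNormal.exists_isBoundaryChart (hν : IsUnitOutwardNormal D ξ ν)
    (hD : IsOpen D) (hξ : ξ ∈ frontier D) :
    ∃ ρ r C B, IsBoundaryChart D ξ ν ρ r C B := by
  obtain ⟨h1, U, ρ₀, h₀, c, hc, hcν⟩ := hν
  obtain ⟨ρ, hρ⟩ : ∃ ρ : EuclideanSpace ℂ (Fin n) → ℝ, ρ = fun x => c⁻¹ * ρ₀ x := ⟨_, rfl⟩
  have hfd : ∀ x ∈ U, fderiv ℝ ρ x = c⁻¹ • fderiv ℝ ρ₀ x := fun x hx => by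
    rw [hρ]; exact fderiv_const_mul (h₀.differentiableAt hx) _
  have h : IsLocalDefiningFunction D ξ U ρ := by
    refine ⟨h₀.isOpen, h₀.mem, ?_, fun x hx => ?_, ?_⟩
    · rw [hρ]; exact contDiffOn_const.mul h₀.contDiffOn
    · rw [hfd x hx]
      exact smul_ne_zero (inv_ne_zero hc.ne') (h₀.fderiv_ne_zero x hx)
    · rw [h₀.inter_eq]
      ext x
      have : c⁻¹ * ρ₀ x < 0 ↔ ρ₀ x < 0 := by
        constructor
        · intro hh; by_contra! h2
          exact absurd hh (mul_nonneg (inv_pos.2 hc).le h2).not_gt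
        · exact mul_neg_of_pos_of_neg (inv_pos.2 hc)
      simp [hρ, this]
  have hfξ : fderiv ℝ ρ ξ = reInner ν := by
    ext v
    rw [hfd ξ h₀.mem, smul_apply, hcν, smul_eq_mul, reInner_apply,
      inv_mul_cancel_left₀ hc.ne']
  have hB : HasFDerivAt (fderiv ℝ ρ) (fderiv ℝ (fderiv ℝ ρ) ξ) ξ :=
    (((h.contDiffAt h.mem).fderiv_right (m := 1) (by norm_num)).differentiableAt
      (by norm_num)).hasFDerivAt
  set B := fderiv ℝ (fderiv ℝ ρ) ξ
  obtain ⟨C, hC, hbig⟩ := hB.isBigO_sub.exists_nonneg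
  have hhalf : ∀ᶠ y in 𝓝 ξ, ‖fderiv ℝ ρ y - reInner ν‖ ≤ 1 / 2 := by
    have := hB.continuousAt.eventually (Metric.closedBall_mem_nhds _ (one_half_pos (α := ℝ)))
    simpa [dist_eq_norm, hfξ] using this
  obtain ⟨r, hr, hball⟩ := Metric.eventually_nhds_iff_ball.1
    ((hbig.bound.and hhalf).and (h.isOpen.mem_nhds h.mem))
  have hsub : Metric.ball ξ r ⊆ U := fun y hy => (hball y hy).2
  refine ⟨ρ, r, C, B, ⟨Metric.isOpen_ball, Metric.mem_ball_self hr, h.contDiffOn.mono hsub,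
    fun x hx => h.fderiv_ne_zero x (hsub hx), ?_⟩, hD, hξ, hr, hC, h1, fun y hy => ?_,
    fun y hy => (hball y hy).1.2, fun ε hε => ?_⟩
  · ext x
    constructor
    · rintro ⟨hx, hxr⟩
      exact ⟨hxr, (h.mem_iff (hsub hxr)).1 hx⟩
    · rintro ⟨hxr, hx⟩
      exact ⟨(h.mem_iff (hsub hxr)).2 hx, hxr⟩
  · rw [← hfξ]; exact (hball y hy).1.1
  · obtain ⟨δ, hδ, hx⟩ := taylor_two_of_hasFDerivAt_fderiv
      (eventually_of_mem (h.isOpen.mem_nhds h.mem) fun x hx => h.differentiableAt hx) hB hε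
    refine ⟨δ, hδ, fun x hxδ => ?_⟩
    simpa [hfξ, h.eq_zero_of_mem_frontier hD h.mem hξ] using hx x hxδ

namespace IsBoundaryChart

variable {ρ : EuclideanSpace ℂ (Fin n) → ℝ} {r C : ℝ}
  {B : EuclideanSpace ℂ (Fin n) →L[ℝ] EuclideanSpace ℂ (Fin n) →L[ℝ] ℝ}
  {x y z p : EuclideanSpace ℂ (Fin n)}

theorem eq_zero (h : IsBoundaryChart D ξ ν ρ r C B) : ρ ξ = 0 :=
  h.defining.eq_zero_of_mem_frontier h.isOpen h.defining.mem h.mem_frontier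

theorem abs_sub_le (h : IsBoundaryChart D ξ ν ρ r C B) (hx : x ∈ Metric.ball ξ r)
    (hy : y ∈ Metric.ball ξ r) :
    |ρ y - ρ x - (inner ℂ ν (y - x)).re| ≤ 1 / 2 * ‖y - x‖ :=
  (convex_ball ξ r).norm_image_sub_le_of_norm_fderiv_le' (𝕜 := ℝ) (φ := reInner ν)
    (fun _ hx => h.defining.differentiableAt hx) h.norm_fderiv_sub_le_half hx hy

/-- The mean value inequality for `ρ - Re (·, ν)`. With `R` of order `√d` and `‖y - x‖ ≤ c √d` the
error is `O(c d)`, which a small `c` makes negligible against `d`. -/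
theorem abs_sub_le_mul (h : IsBoundaryChart D ξ ν ρ r C B) {R : ℝ} (hR : R ≤ r)
    (hx : x ∈ Metric.ball ξ R) (hy : y ∈ Metric.ball ξ R) :
    |ρ y - ρ x - (inner ℂ ν (y - x)).re| ≤ C * R * ‖y - x‖ :=
  (convex_ball ξ R).norm_image_sub_le_of_norm_fderiv_le' (𝕜 := ℝ) (φ := reInner ν)
    (fun _ hx => h.defining.differentiableAt (Metric.ball_subset_ball hR hx))
    (fun y hy => (h.norm_fderiv_sub_le y (Metric.ball_subset_ball hR hy)).trans
      (mul_le_mul_of_nonneg_left (mem_ball_iff_norm.1 hy).le h.nonneg)) hx hy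

theorem abs_sub_le_two_mul (h : IsBoundaryChart D ξ ν ρ r C B) (hx : x ∈ Metric.ball ξ r)
    (hy : y ∈ Metric.ball ξ r) : |ρ y - ρ x| ≤ 2 * ‖y - x‖ := by
  have h1 := abs_le.1 (h.abs_sub_le hx hy)
  have h2 := abs_le.1 (abs_re_inner_le ν (y - x))
  rw [h.norm_eq] at h2
  have := norm_nonneg (y - x)
  exact abs_le.2 ⟨by linarith, by linarith⟩

/-- A lower bound of the distance from the boundary by a defining function. -/
theorem le_infDist (h : IsBoundaryChart D ξ ν ρ r C B) (hp : p ∈ Metric.ball ξ (r / 2)) :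
    -ρ p / 2 ≤ Metric.infDist p (frontier D) := by
  have hr := h.pos
  have hpr : p ∈ Metric.ball ξ r := Metric.ball_subset_ball (by linarith) hp
  refine (Metric.le_infDist ⟨ξ, h.mem_frontier⟩).2 fun q hq => ?_
  rw [dist_comm, dist_eq_norm]
  by_cases hqr : q ∈ Metric.ball ξ r
  · have h0 := h.defining.eq_zero_of_mem_frontier h.isOpen hqr hq
    have := (abs_le.1 (h.abs_sub_le_two_mul hpr hqr)).2
    linarith
  -- Boundary points outside the chart are farther from `p` than `ξ` is, and `‖p - ξ‖ ≥ -ρ p / 2`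
  -- because `ρ ξ = 0`.
  · have h1 := (abs_le.1 (h.abs_sub_le_two_mul hpr h.defining.mem)).2
    rw [h.eq_zero, norm_sub_rev] at h1
    rw [mem_ball_iff_norm] at hp hqr
    have := norm_sub_le_norm_sub_add_norm_sub q p ξ
    linarith

/-- An upper bound of the distance from the boundary by a defining function. -/
theorem infDist_le (h : IsBoundaryChart D ξ ν ρ r C B) (hz : z ∈ D)
    (hzr : z ∈ Metric.ball ξ (r / 2)) : Metric.infDist z (frontier D) ≤ -ρ z * 2 := by
  have hr := h.pos
  set R := Metric.infDist z (frontier D) with hR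
  have hRr : R < r / 2 :=
    (Metric.infDist_le_dist_of_mem h.mem_frontier).trans_lt (Metric.mem_ball.1 hzr)
  have hzr' : z ∈ Metric.ball ξ r := Metric.ball_subset_ball (by linarith) hzr
  have hρz := (h.defining.mem_iff hzr').1 hz
  -- Moving from `z` by `t` along `ν`, with `t` below the boundary distance, stays in `D`, but
  -- raises `ρ` by at least `t / 2`, so past zero once `t > -2 ρ z`.
  by_contra! hlt
  obtain ⟨t, ht1, ht2⟩ := exists_between hlt
  have ht0 : 0 < t := by linarith
  have hdist : dist (z + t • ν) z = t := by
    rw [dist_eq_norm, add_sub_cancel_left, norm_smul, h.norm_eq, Real.norm_of_nonneg ht0.le,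
      mul_one]
  have hw : z + t • ν ∈ Metric.ball ξ r := by
    rw [Metric.mem_ball] at hzr ⊢
    have := dist_triangle (z + t • ν) z ξ
    linarith
  have hsub : Metric.ball z R ⊆ D := by
    refine IsPreconnected.subset_of_disjoint_frontier (convex_ball z R).isPreconnected
      ⟨z, Metric.mem_ball_self (ht0.trans ht2), hz⟩ Metric.disjoint_ball_infDist
  have hwD : z + t • ν ∈ D := hsub (by rw [Metric.mem_ball, hdist]; exact ht2)
  have h1 := (h.defining.mem_iff hw).1 hwD
  have h2 := (abs_le.1 (h.abs_sub_le hzr' hw)).1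
  have h3 : (inner ℂ ν (z + t • ν - z)).re = t := by
    rw [add_sub_cancel_left, ← reInner_apply, map_smul, reInner_apply, re_inner_self, h.norm_eq]
    simp
  rw [h3, ← dist_eq_norm, hdist] at h2
  linarith

/-- The unit outward normal depends on the boundary point in a Lipschitz way at `ξ`. -/
theorem norm_normal_sub_le (h : IsBoundaryChart D ξ ν ρ r C B) {ζ η : EuclideanSpace ℂ (Fin n)}
    (hζ : ζ ∈ frontier D) (hζr : ζ ∈ Metric.ball ξ r) (hη : IsUnitOutwardNormal D ζ η) :
    ‖η - ν‖ ≤ 2 * C * ‖ζ - ξ‖ := by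
  have hdef := h.defining.of_mem hζr
  obtain ⟨η', h1, c, hc, hη'⟩ := hdef.exists_smul_eq
  obtain rfl : η = η' := hη.unique h.isOpen hζ ⟨h1, _, ρ, hdef, c, hc, hη'⟩
  have hK : 0 ≤ C * ‖ζ - ξ‖ := mul_nonneg h.nonneg (norm_nonneg _)
  -- The gradient at `ζ` is `c η`, at distance at most `C ‖ζ - ξ‖` from `ν`. Comparing norms bounds
  -- `|c - 1|` by the same quantity; hence the factor 2.
  have hle : ‖(c : ℂ) • η - ν‖ ≤ C * ‖ζ - ξ‖ := by
    refine norm_le_of_re_inner_le hK fun v => ?_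
    have h2 := (fderiv ℝ ρ ζ - reInner ν).le_of_opNorm_le (h.norm_fderiv_sub_le ζ hζr) v
    refine (le_abs_self _).trans (le_of_eq_of_le ?_ h2)
    rw [Real.norm_eq_abs, sub_apply, hη', reInner_apply, inner_sub_left,
      inner_smul_left, Complex.conj_ofReal, Complex.sub_re, Complex.re_ofReal_mul]
  have hc1 : |c - 1| ≤ C * ‖ζ - ξ‖ := by
    refine le_trans ?_ hle
    have := abs_norm_sub_norm_le ((c : ℂ) • η) ν
    rw [norm_smul, h1, h.norm_eq, Complex.norm_real, Real.norm_of_nonneg hc.le, mul_one] at this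
    exact this
  have h3 : η - ν = ((c : ℂ) • η - ν) - ((c - 1 : ℝ) : ℂ) • η := by
    push_cast
    rw [sub_smul, one_smul]; abel
  rw [h3]
  refine (norm_sub_le _ _).trans ?_
  rw [norm_smul, h1, Complex.norm_real, Real.norm_eq_abs, mul_one]
  linarith

end IsBoundaryChart

end BoundaryChart

/-- A quadratic form changes little if its argument is rescaled and moved along a unit vector. -/
theorem abs_quadratic_sub_le {E : Type*} [NormedAddCommGroup E] [NormedSpace ℝ E]
    (B : E →L[ℝ] E →L[ℝ] ℝ) {ν x : E} {a s : ℝ} (hν : ‖ν‖ = 1) (hs : s ∈ Set.Icc (0 : ℝ) 1)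
    (hax : |a| ≤ ‖x‖) :
    |B ((1 - s) • a • ν + s • x) ((1 - s) • a • ν + s • x) - s ^ 2 * B x x| ≤
      3 * ‖B‖ * ‖x‖ * |a| := by
  have hs1 : 0 ≤ 1 - s := by linarith [hs.2]
  have hs1' : 1 - s ≤ 1 := by linarith [hs.1]
  -- Every term other than `s ^ 2 * B x x` carries a factor `(1 - s) * a`.
  have hQ : B ((1 - s) • a • ν + s • x) ((1 - s) • a • ν + s • x) - s ^ 2 * B x x =
      ((1 - s) * (a * B ν ν) + s * (B ν x + B x ν)) * ((1 - s) * a) := by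
    simp
    ring
  have e1 : |B ν ν| ≤ ‖B‖ := by simpa [hν] using B.le_opNorm₂ ν ν
  have e2 : |B ν x| ≤ ‖B‖ * ‖x‖ := by simpa [hν] using B.le_opNorm₂ ν x
  have e3 : |B x ν| ≤ ‖B‖ * ‖x‖ := by simpa [hν] using B.le_opNorm₂ x ν
  have e4 : |(1 - s) * (a * B ν ν)| ≤ ‖x‖ * ‖B‖ := by
    rw [abs_mul, abs_of_nonneg hs1, abs_mul]
    exact (mul_le_of_le_one_left (by positivity) hs1').trans (by gcongr)
  have e5 : |s * (B ν x + B x ν)| ≤ ‖B‖ * ‖x‖ + ‖B‖ * ‖x‖ := by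
    rw [abs_mul, abs_of_nonneg hs.1]
    exact (mul_le_of_le_one_left (abs_nonneg _) hs.2).trans
      ((abs_add_le _ _).trans (add_le_add e2 e3))
  rw [hQ, abs_mul, abs_mul (1 - s), abs_of_nonneg hs1]
  have e6 := (abs_add_le _ _).trans (add_le_add e4 e5)
  gcongr
  · linarith
  · exact mul_le_of_le_one_left (abs_nonneg _) hs1'

/-! ### Geometry of admissible domains. -/

section AdmissibleDomain

variable {n : ℕ} {D : Set (EuclideanSpace ℂ (Fin n))} {ξ ν : EuclideanSpace ℂ (Fin n)} {α : ℝ}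
  {z : EuclideanSpace ℂ (Fin n)}

theorem vertexDist_pos_of_mem (hα : 0 < α) (hz : z ∈ admissibleDomain D ξ ν α) :
    0 < vertexDist D ξ ν z :=
  pos_of_mul_pos_right ((sq_nonneg _).trans_lt hz.2.2.2) hα.le

theorem vertexDist_le_infDist : vertexDist D ξ ν z ≤ Metric.infDist z (frontier D) :=
  min_le_left _ _

theorem re_inner_le_neg_vertexDist (hν : ‖ν‖ = 1) (hz : z ∈ admissibleDomain D ξ ν α) :
    (inner ℂ ν (z - ξ)).re ≤ -vertexDist D ξ ν z := by
  have : vertexDist D ξ ν z ≤ _ := min_le_right _ _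
  rw [infDist_realTangentPlane hν, abs_of_neg hz.2.1] at this
  linarith

theorem vertexDist_le_norm (hξ : ξ ∈ frontier D) : vertexDist D ξ ν z ≤ ‖z - ξ‖ :=
  dist_eq_norm z ξ ▸ vertexDist_le_infDist.trans (Metric.infDist_le_dist_of_mem hξ)

theorem norm_sub_le_of_isClosestBoundaryPoint (hξ : ξ ∈ frontier D)
    {ζ : EuclideanSpace ℂ (Fin n)} (hζ : IsClosestBoundaryPoint D z ζ) :
    ‖ζ - ξ‖ ≤ 2 * ‖z - ξ‖ := by
  have h1 : dist z ζ ≤ dist z ξ := hζ.2 ▸ Metric.infDist_le_dist_of_mem hξ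
  have h2 := dist_triangle_left ζ ξ z
  rw [dist_eq_norm ζ, dist_eq_norm z ξ] at h2
  rw [dist_eq_norm z ξ] at h1
  linarith

theorem exists_isClosestBoundaryPoint (hξ : ξ ∈ frontier D) (z : EuclideanSpace ℂ (Fin n)) :
    ∃ ζ, IsClosestBoundaryPoint D z ζ := by
  obtain ⟨ζ, hζ, h⟩ := isClosed_frontier.exists_infDist_eq_dist ⟨ξ, hξ⟩ z
  exact ⟨ζ, hζ, h.symm⟩

namespace IsBoundaryChart

variable {ρ : EuclideanSpace ℂ (Fin n) → ℝ} {r C : ℝ}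
  {B : EuclideanSpace ℂ (Fin n) →L[ℝ] EuclideanSpace ℂ (Fin n) →L[ℝ] ℝ}
  {y w : EuclideanSpace ℂ (Fin n)}

theorem le_neg_vertexDist (h : IsBoundaryChart D ξ ν ρ r C B)
    (hz : z ∈ admissibleDomain D ξ ν α) (hzr : z ∈ Metric.ball ξ (r / 2)) :
    ρ z ≤ -vertexDist D ξ ν z / 2 := by
  have h1 := h.infDist_le hz.1 hzr
  have h2 := vertexDist_le_infDist (D := D) (ξ := ξ) (ν := ν) (z := z)
  linarith

/-- The bounds on `ρ` and on the height over the tangent plane each keep one of the two distances at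
least `e`, so `e` may replace `vertexDist` in the remaining conditions. -/
theorem mem_admissibleDomain (h : IsBoundaryChart D ξ ν ρ r C B)
    (hy : y ∈ Metric.ball ξ (r / 2)) {e : ℝ} (he : 0 < e) (hρ : ρ y ≤ -(2 * e))
    (hre : (inner ℂ ν (y - ξ)).re ≤ -e) (hα : 0 < α)
    (h1 : ‖inner ℂ ν (y - ξ)‖ < (1 + α) * e) (h2 : ‖y - ξ‖ ^ 2 < α * e) :
    y ∈ admissibleDomain D ξ ν α ∧ e ≤ vertexDist D ξ ν y := by
  have hr := h.pos
  have hle : e ≤ vertexDist D ξ ν y := by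
    refine le_min ?_ ?_
    · have := h.le_infDist hy
      linarith
    · rw [infDist_realTangentPlane h.norm_eq]
      exact (le_neg.1 hre).trans (neg_le_abs _)
  refine ⟨⟨?_, by linarith, h1.trans_le ?_, h2.trans_le ?_⟩, hle⟩
  · exact (h.defining.mem_iff (Metric.ball_subset_ball (by linarith) hy)).2 (by linarith)
  · gcongr
  · gcongr

/-- Admissible domains contain translates of their points by vectors of length `O(√δ)` whose
complex normal part at `ξ` is of length `O(δ)`. -/
theorem add_mem_admissibleDomain (h : IsBoundaryChart D ξ ν ρ r C B) (hα : 0 < α)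
    (hz : z ∈ admissibleDomain D ξ ν α) {c : ℝ} (hc1 : c ≤ 1)
    (hC : C * (√α + 2) * c ≤ 1 / 8) (hr : (√α + 2) * √(vertexDist D ξ ν z) ≤ r / 2)
    (hw : ‖w‖ ≤ c * √(vertexDist D ξ ν z)) (hνw : ‖inner ℂ ν w‖ ≤ vertexDist D ξ ν z / 8) :
    z + w ∈ admissibleDomain D ξ ν (8 * (√α + 2) ^ 2) := by
  have hd := vertexDist_pos_of_mem hα hz
  have hre := re_inner_le_neg_vertexDist h.norm_eq hz
  have hzα := hz.2.2
  have hρz := h.le_neg_vertexDist hz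
  set d := vertexDist D ξ ν z
  have hsd : 0 < √d := Real.sqrt_pos.2 hd
  have hsα : 0 < √α := Real.sqrt_pos.2 hα
  have hsq : √d * √d = d := Real.mul_self_sqrt hd.le
  have hsqα : √α ^ 2 = α := Real.sq_sqrt hα.le
  have hr0 := h.pos
  have hzn : ‖z - ξ‖ < √α * √d := by
    refine lt_of_pow_lt_pow_left₀ 2 (by positivity) (hzα.2.trans_eq ?_)
    rw [mul_pow, Real.sq_sqrt hα.le, Real.sq_sqrt hd.le]
  have hw1 : ‖w‖ ≤ √d := hw.trans (mul_le_of_le_one_left hsd.le hc1)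
  have hzR : z ∈ Metric.ball ξ ((√α + 2) * √d) := by
    rw [mem_ball_iff_norm]; nlinarith
  have hadd : z + w - ξ = (z - ξ) + w := by abel
  have hyR : z + w ∈ Metric.ball ξ ((√α + 2) * √d) := by
    rw [mem_ball_iff_norm, hadd]
    have := norm_add_le (z - ξ) w
    nlinarith
  have hρ := (abs_le.1 (h.abs_sub_le_mul (hr.trans (by linarith)) hzR hyR)).2
  rw [add_sub_cancel_left] at hρ
  have hrew := abs_le.1 ((Complex.abs_re_le_norm _).trans hνw)
  have hCd : C * ((√α + 2) * √d) * ‖w‖ ≤ d / 8 := by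
    calc C * ((√α + 2) * √d) * ‖w‖ ≤ C * ((√α + 2) * √d) * (c * √d) := by
          have := h.nonneg
          gcongr
      _ = C * (√α + 2) * c * (√d * √d) := by ring
      _ = C * (√α + 2) * c * d := by rw [hsq]
      _ ≤ 1 / 8 * d := by gcongr
      _ = d / 8 := by ring
  have hρz' := hρz (Metric.ball_subset_ball hr hzR)
  -- From `ρ z ≤ -d/2`, the linear term and the error raise `ρ` by at most `d/8` each, leaving `-d/4
  -- = -2 (d/8)`. The factor 8 in the aperture compensates for `e = d/8`.
  refine (h.mem_admissibleDomain (Metric.ball_subset_ball hr hyR) (e := d / 8) (by positivity)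
    (by linarith) ?_ (by positivity) ?_ ?_).1
  · rw [hadd, inner_add_right, Complex.add_re]
    linarith
  · rw [hadd, inner_add_right]
    refine (norm_add_le _ _).trans_lt ?_
    nlinarith
  · have h1 := pow_lt_pow_left₀ (mem_ball_iff_norm.1 hyR) (norm_nonneg _) two_ne_zero
    refine h1.trans_eq ?_
    rw [mul_pow, Real.sq_sqrt hd.le]
    ring

/-- Near `ξ`, the segments in real tangential directions from the points of an admissible domain to
the normal lie in a larger admissible domain. -/
theorem segment_mem_admissibleDomain (h : IsBoundaryChart D ξ ν ρ r C B) (hα : 0 < α) :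
    ∀ᶠ z in 𝓝 ξ, z ∈ admissibleDomain D ξ ν α → ∀ s ∈ Set.Icc (0 : ℝ) 1, ∀ y,
      y = ξ + ((1 - s) • (inner ℂ ν (z - ξ)).re • ν + s • (z - ξ)) →
      y ∈ admissibleDomain D ξ ν (8 * (1 + α)) ∧ vertexDist D ξ ν z / 8 ≤ vertexDist D ξ ν y ∧
        ‖y - ξ‖ ≤ ‖z - ξ‖ := by
  -- Since `‖z - ξ‖² < α d`, this precision makes the Taylor error at most `d / 16`.
  obtain ⟨δ, hδ, htaylor⟩ := h.taylor (1 / (16 * α)) (by positivity)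
  have hr := h.pos
  have hcont : Tendsto (fun z => 3 / 2 * ‖B‖ * (1 + α) * ‖z - ξ‖) (𝓝 ξ) (𝓝 0) := by
    have : Continuous fun z => 3 / 2 * ‖B‖ * (1 + α) * ‖z - ξ‖ := by fun_prop
    simpa using this.tendsto ξ
  filter_upwards [Metric.ball_mem_nhds ξ hδ, Metric.ball_mem_nhds ξ (half_pos hr),
    hcont.eventually (gt_mem_nhds (by norm_num : (0 : ℝ) < 1 / 8))]
    with z hzδ hzr hzB hz s hs y hy
  have hd := vertexDist_pos_of_mem hα hz
  have hre := re_inner_le_neg_vertexDist h.norm_eq hz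
  have hzα := hz.2.2
  have hρz := h.le_neg_vertexDist hz hzr
  set d := vertexDist D ξ ν z
  set x := z - ξ with hx
  set a := (inner ℂ ν x).re with ha
  have haN : |a| ≤ ‖inner ℂ ν x‖ := Complex.abs_re_le_norm _
  have hax : |a| ≤ ‖x‖ := by simpa [h.norm_eq] using abs_re_inner_le ν x
  have hs1 : 0 ≤ 1 - s := by linarith [hs.2]
  have hyx : y - ξ = (1 - s) • a • ν + s • x := by rw [hy, add_sub_cancel_left]
  have hny : ‖y - ξ‖ ≤ ‖x‖ := by
    rw [hyx]
    refine (norm_add_le _ _).trans ?_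
    rw [norm_smul, norm_smul, norm_smul, h.norm_eq, Real.norm_of_nonneg hs1,
      Real.norm_of_nonneg hs.1, Real.norm_eq_abs, mul_one]
    linarith [mul_le_mul_of_nonneg_left hax hs1]
  have hNy : inner ℂ ν (y - ξ) = ((1 - s : ℝ) : ℂ) * (a : ℂ) + (s : ℂ) * inner ℂ ν x := by
    have h1 : inner ℂ ν ν = (1 : ℂ) := by
      rw [inner_self_eq_norm_sq_to_K, h.norm_eq]; simp
    rw [hyx, ← Complex.coe_smul (1 - s), ← Complex.coe_smul a, ← Complex.coe_smul s,
      inner_add_right, inner_smul_right, inner_smul_right, inner_smul_right, h1, mul_one]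
  have hrey : (inner ℂ ν (y - ξ)).re = a := by
    rw [hNy, Complex.add_re, Complex.re_ofReal_mul, Complex.re_ofReal_mul, Complex.ofReal_re,
      ← ha]
    ring
  have hNy' : ‖inner ℂ ν (y - ξ)‖ ≤ ‖inner ℂ ν x‖ := by
    rw [hNy]
    refine (norm_add_le _ _).trans ?_
    rw [norm_mul, norm_mul, Complex.norm_real, Complex.norm_real, Complex.norm_real,
      Real.norm_of_nonneg hs1, Real.norm_of_nonneg hs.1, Real.norm_eq_abs]
    linarith [mul_le_mul_of_nonneg_left haN hs1]
  have hyball : ∀ {R}, z ∈ Metric.ball ξ R → y ∈ Metric.ball ξ R := fun hzR => by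
    rw [mem_ball_iff_norm] at hzR ⊢
    exact hny.trans_lt hzR
  have hQ := abs_quadratic_sub_le B h.norm_eq hs hax
  rw [← hyx] at hQ
  have hdiff : 3 * ‖B‖ * ‖x‖ * |a| ≤ 3 * ‖B‖ * ‖x‖ * ((1 + α) * d) := by
    gcongr
    exact haN.trans hzα.1.le
  have hε : 1 / (16 * α) * ‖x‖ ^ 2 ≤ d / 16 := by
    calc 1 / (16 * α) * ‖x‖ ^ 2 ≤ 1 / (16 * α) * (α * d) := by gcongr; exact hzα.2.le
      _ = d / 16 := by field_simp
  have hε' : 1 / (16 * α) * ‖y - ξ‖ ^ 2 ≤ d / 16 := le_trans (by gcongr) hε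
  have hTz := abs_le.1 ((htaylor z hzδ).trans hε)
  have hTy := abs_le.1 ((htaylor y (hyball hzδ)).trans hε')
  rw [hrey] at hTy
  rw [← hx, ← ha] at hTz
  have hQ' := ((le_abs_self _).trans hQ).trans hdiff
  have hs2 : s ^ 2 ≤ 1 := pow_le_one₀ hs.1 hs.2
  -- Eliminating `B x x` between the expansions at `y` and `z` gives `ρ y ≈ s² ρ z + (1 - s²) a ≤
  -- -d/2`. The errors are at most `d/16` for each expansion and `d/8` for the cross terms, in total
  -- `d/4`.
  have hρy : ρ y ≤ -(2 * (d / 8)) := by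
    have e1 : s ^ 2 * (B x x / 2) ≤ s ^ 2 * (ρ z - a + d / 16) :=
      mul_le_mul_of_nonneg_left (by linarith) (sq_nonneg s)
    have e2 : s ^ 2 * ρ z ≤ s ^ 2 * (-d / 2) := mul_le_mul_of_nonneg_left hρz (sq_nonneg s)
    have e3 : (1 - s ^ 2) * a ≤ (1 - s ^ 2) * (-d) :=
      mul_le_mul_of_nonneg_left hre (by linarith)
    have e4 : 3 / 2 * ‖B‖ * (1 + α) * ‖x‖ * d ≤ 1 / 8 * d := by gcongr
    have e5 : s ^ 2 * d ≤ d := mul_le_of_le_one_left hd.le hs2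
    linarith
  obtain ⟨m1, m2⟩ := h.mem_admissibleDomain (hyball hzr) (e := d / 8) (α := 8 * (1 + α))
    (by positivity) hρy (by rw [hrey]; linarith) (by positivity)
    (hNy'.trans_lt (hzα.1.trans_le (by nlinarith [mul_pos hα hd])))
    (lt_of_le_of_lt (by gcongr) (hzα.2.trans_le (by nlinarith [mul_pos hα hd])))
  exact ⟨m1, m2, hny⟩

end IsBoundaryChart

end AdmissibleDomain

/-! ### The Riemann sphere in stereographic coordinates. -/

section Spherical

theorem OnePoint.tendsto_coe_infty_iff {ι : Type*} {l : Filter ι} {u : ι → ℂ} :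
    Tendsto (fun i => (u i : OnePoint ℂ)) l (𝓝 (OnePoint.infty : OnePoint ℂ)) ↔
      Tendsto (fun i => ‖u i‖) l atTop := by
  rw [tendsto_norm_atTop_iff_cobounded, Metric.cobounded_eq_cocompact,
    ← coclosedCompact_eq_cocompact, ← OnePoint.comap_coe_nhds_infty, tendsto_comap_iff]
  rfl

theorem OnePoint.tendsto_coe_coe_iff {ι : Type*} {l : Filter ι} {u : ι → ℂ} {a : ℂ} :
    Tendsto (fun i => (u i : OnePoint ℂ)) l (𝓝 (a : OnePoint ℂ)) ↔ Tendsto u l (𝓝 a) :=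
  OnePoint.isOpenEmbedding_coe.isEmbedding.tendsto_nhds_iff.symm

/-- The stereographic projection from the plane to the sphere, up to an affine map. -/
noncomputable def stereo (w : ℂ) : ℂ × ℝ :=
  (((1 + ‖w‖ ^ 2 : ℝ)⁻¹ : ℝ) • w, (1 + ‖w‖ ^ 2)⁻¹)

/-- The stereographic projection, up to an affine map, of the extended plane. -/
noncomputable def stereoExt : OnePoint ℂ → ℂ × ℝ
  | OnePoint.infty => (0, 0)
  | OnePoint.some w => stereo w

theorem continuous_stereo : Continuous stereo := by
  have : ∀ w : ℂ, 1 + ‖w‖ ^ 2 ≠ 0 := fun w => by positivity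
  unfold stereo
  fun_prop (disch := exact this _)

theorem norm_stereo_fst (w : ℂ) : ‖(stereo w).1‖ = ‖w‖ / (1 + ‖w‖ ^ 2) := by
  have : 0 < 1 + ‖w‖ ^ 2 := by positivity
  simp only [stereo]
  rw [norm_smul, Real.norm_of_nonneg (by positivity), div_eq_inv_mul]

theorem tendsto_stereo_infty {ι : Type*} {l : Filter ι} {u : ι → ℂ}
    (h : Tendsto (fun i => ‖u i‖) l atTop) : Tendsto (fun i => stereo (u i)) l (𝓝 (0, 0)) := by
  have hinv := h.inv_tendsto_atTop
  rw [nhds_prod_eq]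
  refine Tendsto.prodMk ?_ ?_
  · refine squeeze_zero_norm (fun i => ?_) hinv
    refine (norm_stereo_fst (u i)).trans_le ?_
    simp only [Pi.inv_apply]
    rcases eq_or_ne ‖u i‖ 0 with h0 | h0
    · simp [h0]
    · have : 0 < ‖u i‖ := lt_of_le_of_ne (norm_nonneg _) h0.symm
      rw [div_le_iff₀ (by positivity), mul_add, sq, inv_mul_cancel_left₀ h0]
      have := inv_pos.2 this
      linarith
  · have h2 : Tendsto (fun i => 1 + ‖u i‖ ^ 2) l atTop :=
      tendsto_atTop_add_const_left _ _ ((tendsto_pow_atTop two_ne_zero).comp h)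
    exact h2.inv_tendsto_atTop

/-- Convergence in the extended plane is convergence of the stereographic projections. -/
theorem tendsto_coe_iff_tendsto_stereo {ι : Type*} {l : Filter ι} {u : ι → ℂ} {L : OnePoint ℂ} :
    Tendsto (fun i => (u i : OnePoint ℂ)) l (𝓝 L) ↔
      Tendsto (fun i => stereo (u i)) l (𝓝 (stereoExt L)) := by
  induction L using OnePoint.rec with
  | infty =>
    rw [OnePoint.tendsto_coe_infty_iff]
    refine ⟨tendsto_stereo_infty, fun h => ?_⟩
    have h2 : Tendsto (fun i => (stereo (u i)).2) l (𝓝[>] 0) := by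
      refine tendsto_nhdsWithin_iff.2 ⟨(continuous_snd.tendsto _).comp h, .of_forall fun i => ?_⟩
      simp only [stereo, Set.mem_Ioi]
      positivity
    have h3 : Tendsto (fun i => 1 + ‖u i‖ ^ 2) l atTop := by
      simpa [stereo, Function.comp_def] using tendsto_inv_nhdsGT_zero.comp h2
    refine tendsto_atTop.2 fun M => ?_
    filter_upwards [h3.eventually_ge_atTop (1 + |M| ^ 2)] with i hi
    exact (le_abs_self M).trans
      (le_of_sq_le_sq (by linarith) (norm_nonneg _))
  | coe a =>
    rw [OnePoint.tendsto_coe_coe_iff]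
    refine ⟨(continuous_stereo.tendsto a).comp, fun h => ?_⟩
    have h1 : Tendsto (fun i => (stereo (u i)).1) l (𝓝 (stereo a).1) :=
      (continuous_fst.tendsto _).comp h
    have h2 : Tendsto (fun i => (stereo (u i)).2) l (𝓝 (stereo a).2) :=
      (continuous_snd.tendsto _).comp h
    -- A finite point is the quotient of its stereographic coordinates, and the denominator does not
    -- vanish at `a`.
    have key : ∀ w, ((stereo w).2)⁻¹ • (stereo w).1 = w := fun w => by
      have : 1 + ‖w‖ ^ 2 ≠ 0 := by positivity
      simp only [stereo]
      rw [inv_inv, smul_inv_smul₀ this]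
    have h0 : (stereo a).2 ≠ 0 := by
      simp only [stereo]
      positivity
    simpa only [key] using (h2.inv₀ h0).smul h1

/-- The stereographic projection is Lipschitz with respect to the spherical metric, along paths. -/
theorem norm_stereo_sub_le {h h' : ℝ → ℂ} {K : ℝ}
    (hd : ∀ t ∈ Set.Icc (0 : ℝ) 1, HasDerivWithinAt h (h' t) (Set.Icc 0 1) t)
    (hK : ∀ t ∈ Set.Icc (0 : ℝ) 1, ‖h' t‖ / (1 + ‖h t‖ ^ 2) ≤ K) :
    ‖stereo (h 1) - stereo (h 0)‖ ≤ 3 * K := by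
  have hpos : ∀ t, 0 < 1 + ‖h t‖ ^ 2 := fun t => by positivity
  have hK0 : 0 ≤ K := le_trans (by positivity) (hK 0 (by simp))
  -- The derivative of `(1 + ‖h‖²)⁻¹` enters the second coordinate with weight 1 and the first with
  -- weight `‖h‖`; the maximum treats both. The term `h' / (1 + ‖h‖²)` of the first coordinate adds
  -- another `K`, whence 3.
  have hcoef : ∀ t ∈ Set.Icc (0 : ℝ) 1,
      ‖-(2 * inner ℝ (h t) (h' t)) / (1 + ‖h t‖ ^ 2) ^ 2‖ * max 1 ‖h t‖ ≤ 2 * K := by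
    intro t ht
    have h1 := hK t ht
    rw [div_le_iff₀ (hpos t)] at h1
    have h2 : |inner ℝ (h t) (h' t)| ≤ ‖h t‖ * ‖h' t‖ := abs_real_inner_le_norm _ _
    rw [norm_div, norm_neg, norm_mul, Real.norm_eq_abs, Real.norm_eq_abs, Real.norm_eq_abs,
      abs_of_pos (pow_pos (hpos t) 2), abs_two, div_mul_eq_mul_div, div_le_iff₀ (pow_pos (hpos t) 2)]
    have h3 : ‖h t‖ * max 1 ‖h t‖ ≤ 1 + ‖h t‖ ^ 2 := by
      rcases max_cases 1 ‖h t‖ with ⟨h4, -⟩ | ⟨h4, -⟩ <;> rw [h4] <;>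
         nlinarith [sq_nonneg (‖h t‖ - 1)]
    calc 2 * |inner ℝ (h t) (h' t)| * max 1 ‖h t‖
        ≤ 2 * (‖h t‖ * ‖h' t‖) * max 1 ‖h t‖ := by gcongr
      _ = 2 * (‖h t‖ * max 1 ‖h t‖) * ‖h' t‖ := by ring
      _ ≤ 2 * (1 + ‖h t‖ ^ 2) * (K * (1 + ‖h t‖ ^ 2)) := by gcongr
      _ = 2 * K * (1 + ‖h t‖ ^ 2) ^ 2 := by ring
  have hd2 : ∀ t ∈ Set.Icc (0 : ℝ) 1, HasDerivWithinAt (fun t => (1 + ‖h t‖ ^ 2)⁻¹)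
      (-(2 * inner ℝ (h t) (h' t)) / (1 + ‖h t‖ ^ 2) ^ 2) (Set.Icc 0 1) t := fun t ht =>
    ((hd t ht).norm_sq.const_add 1).inv (hpos t).ne'
  have hd1 := fun t ht => (hd2 t ht).smul (hd t ht)
  have hd0 := fun t ht => (hd1 t ht).prodMk (hd2 t ht)
  refine norm_image_sub_le_of_norm_deriv_le_segment_01' hd0 fun t ht => ?_
  have ht' : t ∈ Set.Icc (0 : ℝ) 1 := ⟨ht.1, ht.2.le⟩
  have hc := hcoef t ht'
  have e1 := (mul_le_mul_of_nonneg_left (le_max_left 1 ‖h t‖) (norm_nonneg _)).trans hc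
  have e2 := (mul_le_mul_of_nonneg_left (le_max_right 1 ‖h t‖) (norm_nonneg _)).trans hc
  have e3 := hK t ht'
  rw [div_eq_inv_mul] at e3
  refine norm_prod_le_iff.2 ⟨(norm_add_le _ _).trans ?_, by linarith⟩
  rw [norm_smul, norm_smul, Real.norm_of_nonneg (inv_nonneg.2 (hpos t).le)]
  linarith

end Spherical

/-! ### Cauchy estimates for the spherical derivative. -/

section SphericalDeriv

variable {n : ℕ} {f : EuclideanSpace ℂ (Fin n) → ℂ} {z v w : EuclideanSpace ℂ (Fin n)}

theorem sphericalDeriv_nonneg : 0 ≤ sphericalDeriv f z v := by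
  unfold sphericalDeriv; positivity

theorem sphericalDeriv_add_le :
    sphericalDeriv f z (v + w) ≤ sphericalDeriv f z v + sphericalDeriv f z w := by
  unfold sphericalDeriv
  rw [map_add, ← add_div]
  gcongr
  exact norm_add_le _ _

theorem sphericalDeriv_smul (c : ℂ) :
    sphericalDeriv f z (c • v) = ‖c‖ * sphericalDeriv f z v := by
  unfold sphericalDeriv
  rw [map_smul, norm_smul, mul_div_assoc]

theorem hasDerivAt_comp_line (hf : DifferentiableAt ℂ f (z + w)) {c : ℂ} (hc : c • v = w) :
    HasDerivAt (fun l : ℂ => f (z + l • v)) (fderiv ℂ f (z + w) v) c := by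
  have hline : HasDerivAt (fun l : ℂ => z + l • v) v c := by
    simpa using ((hasDerivAt_id c).smul_const v).const_add z
  subst hc
  exact hf.hasFDerivAt.comp_hasDerivAt c hline

/-- Cauchy's estimate of the spherical derivative, for functions that are near a finite value. -/
theorem sphericalDeriv_le_of_norm_sub_le {R ε : ℝ} {a : ℂ} (hR : 0 < R)
    (hf : ∀ l : ℂ, ‖l‖ ≤ R → DifferentiableAt ℂ f (z + l • v) ∧ ‖f (z + l • v) - a‖ ≤ ε) :
    sphericalDeriv f z v ≤ ε / R := by
  have hder : ∀ l : ℂ, ‖l‖ ≤ R →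
      HasDerivAt (fun l : ℂ => f (z + l • v) - a) (fderiv ℂ f (z + l • v) v) l := fun l hl =>
    (hasDerivAt_comp_line (hf l hl).1 rfl).sub_const a
  have hcl : DiffContOnCl ℂ (fun l : ℂ => f (z + l • v) - a) (Metric.ball 0 R) := by
    refine DifferentiableOn.diffContOnCl fun l hl => ?_
    rw [closure_ball _ hR.ne', mem_closedBall_zero_iff] at hl
    exact (hder l hl).differentiableAt.differentiableWithinAt
  have h1 := Complex.norm_deriv_le_of_forall_mem_sphere_norm_le hR hcl fun l hl =>
    (hf l (mem_sphere_zero_iff_norm.1 hl).le).2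
  have h2 := (hder 0 (by simpa using hR.le)).deriv
  rw [zero_smul, add_zero] at h2
  rw [h2] at h1
  exact (div_le_self (norm_nonneg _) (by nlinarith [sq_nonneg ‖f z‖])).trans h1

/-- Inversion is an isometry of the sphere; this reduces large values of `f` to values near zero. -/
theorem sphericalDeriv_inv (hf : DifferentiableAt ℂ f z) (h0 : f z ≠ 0) :
    sphericalDeriv (fun x => (f x)⁻¹) z v = sphericalDeriv f z v := by
  have hn : ‖f z‖ ≠ 0 := norm_ne_zero_iff.2 h0
  have hd : HasFDerivAt (fun x => (f x)⁻¹) (-((f z) ^ 2)⁻¹ • fderiv ℂ f z) z :=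
    (hasDerivAt_inv h0).comp_hasFDerivAt z hf.hasFDerivAt
  unfold sphericalDeriv
  rw [hd.fderiv]
  simp only [smul_apply, norm_smul, norm_neg, norm_inv, norm_pow]
  field_simp
  ring

/-- Cauchy's estimate of the spherical derivative, for functions that are large. -/
theorem sphericalDeriv_le_of_le_norm {R ε : ℝ} (hR : 0 < R) (hε : 0 < ε)
    (hf : ∀ l : ℂ, ‖l‖ ≤ R → DifferentiableAt ℂ f (z + l • v) ∧ ε⁻¹ ≤ ‖f (z + l • v)‖) :
    sphericalDeriv f z v ≤ ε / R := by
  have hne : ∀ l : ℂ, ‖l‖ ≤ R → f (z + l • v) ≠ 0 := fun l hl =>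
    norm_pos_iff.1 ((inv_pos.2 hε).trans_le (hf l hl).2)
  have hz := hf 0 (by simpa using hR.le)
  have hz0 := hne 0 (by simpa using hR.le)
  rw [zero_smul, add_zero] at hz hz0
  rw [← sphericalDeriv_inv hz.1 hz0]
  refine sphericalDeriv_le_of_norm_sub_le (a := 0) hR fun l hl => ⟨(hf l hl).1.inv (hne l hl), ?_⟩
  rw [sub_zero, norm_inv]
  exact inv_le_of_inv_le₀ hε (hf l hl).2

/-- Cauchy's estimate of the spherical derivative, for functions near a point of the sphere. -/
theorem exists_nhds_sphericalDeriv_le (L : OnePoint ℂ) {ε : ℝ} (hε : 0 < ε) :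
    ∃ V ∈ 𝓝 L, ∀ (f : EuclideanSpace ℂ (Fin n) → ℂ) (z v : EuclideanSpace ℂ (Fin n)) (R : ℝ),
      0 < R → (∀ l : ℂ, ‖l‖ ≤ R → DifferentiableAt ℂ f (z + l • v) ∧
        (f (z + l • v) : OnePoint ℂ) ∈ V) → sphericalDeriv f z v ≤ ε / R := by
  induction L using OnePoint.rec with
  | infty =>
    have hM : ∀ᶠ w : ℂ in comap (↑) (𝓝 (OnePoint.infty : OnePoint ℂ)), ε⁻¹ ≤ ‖w‖ :=
      (OnePoint.tendsto_coe_infty_iff.1 tendsto_comap).eventually_ge_atTop _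
    obtain ⟨V, hV, hVM⟩ := mem_comap.1 hM
    exact ⟨V, hV, fun f z v R hR h => sphericalDeriv_le_of_le_norm hR hε fun l hl =>
      ⟨(h l hl).1, hVM (h l hl).2⟩⟩
  | coe a =>
    refine ⟨_, OnePoint.isOpenEmbedding_coe.image_mem_nhds.2 (Metric.closedBall_mem_nhds a hε),
      fun f z v R hR h => sphericalDeriv_le_of_norm_sub_le (a := a) hR fun l hl =>
        ⟨(h l hl).1, ?_⟩⟩
    obtain ⟨w, hw, hwf⟩ := (h l hl).2
    rw [← OnePoint.coe_injective hwf, ← dist_eq_norm]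
    exact hw

end SphericalDeriv

/-! ### The two implications. -/

section AdmissibleLimit

variable {n : ℕ} {D : Set (EuclideanSpace ℂ (Fin n))} {ξ ν : EuclideanSpace ℂ (Fin n)} {α : ℝ}
  {f : EuclideanSpace ℂ (Fin n) → ℂ}

namespace IsBoundaryChart

variable {ρ : EuclideanSpace ℂ (Fin n) → ℝ} {r C : ℝ}
  {B : EuclideanSpace ℂ (Fin n) →L[ℝ] EuclideanSpace ℂ (Fin n) →L[ℝ] ℝ}

/-- If `f` has an admissible limit, then its spherical derivative is `o(1 / R)` in directions in
which admissible domains contain discs of radius `R`. -/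
theorem sphericalDeriv_le_of_hasAdmissibleLimit (h : IsBoundaryChart D ξ ν ρ r C B)
    (hf : DifferentiableOn ℂ f D) {L : OnePoint ℂ} (hL : HasAdmissibleLimit D f ξ ν L)
    (hα : 0 < α) {c : ℝ} (hc1 : c ≤ 1) (hC : C * (√α + 2) * c ≤ 1 / 8) {ε : ℝ} (hε : 0 < ε) :
    ∀ᶠ z in 𝓝 ξ, z ∈ admissibleDomain D ξ ν α → ∀ v R, 0 < R →
      R * ‖v‖ ≤ c * √(vertexDist D ξ ν z) → R * ‖inner ℂ ν v‖ ≤ vertexDist D ξ ν z / 8 →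
      sphericalDeriv f z v ≤ ε / R := by
  have hr := h.pos
  obtain ⟨V, hV, hCauchy⟩ := exists_nhds_sphericalDeriv_le (n := n) L hε
  have hβ : 0 < 8 * (√α + 2) ^ 2 := by positivity
  obtain ⟨δ, hδ, hball⟩ := Metric.eventually_nhds_iff_ball.1
    (eventually_nhdsWithin_iff.1 ((hL _ hβ).eventually_mem hV))
  have h1 : Tendsto (fun z => (√α + 2) * √‖z - ξ‖) (𝓝 ξ) (𝓝 0) := by
    have : Continuous fun z => (√α + 2) * √‖z - ξ‖ := by fun_prop
    simpa using this.tendsto ξ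
  have h2 : Tendsto (fun z => ‖z - ξ‖ + √‖z - ξ‖) (𝓝 ξ) (𝓝 0) := by
    have : Continuous fun z => ‖z - ξ‖ + √‖z - ξ‖ := by fun_prop
    simpa using this.tendsto ξ
  filter_upwards [h1.eventually (gt_mem_nhds (half_pos hr)), h2.eventually (gt_mem_nhds hδ)]
    with z hz1 hz2 hz v R hR hv hνv
  have hd : √(vertexDist D ξ ν z) ≤ √‖z - ξ‖ :=
    Real.sqrt_le_sqrt (vertexDist_le_norm h.mem_frontier)
  refine hCauchy f z v R hR fun l hl => ?_
  have hlv : ‖l • v‖ ≤ R * ‖v‖ := by rw [norm_smul]; gcongr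
  have hmem := h.add_mem_admissibleDomain hα hz hc1 hC
    ((mul_le_mul_of_nonneg_left hd (by positivity)).trans hz1.le) (hlv.trans hv) (by
      rw [inner_smul_right, norm_mul]
      exact le_trans (by gcongr) hνv)
  refine ⟨hf.differentiableAt (h.isOpen.mem_nhds hmem.1), hball _ ?_ hmem⟩
  rw [mem_ball_iff_norm, add_sub_right_comm]
  have h3 : c * √(vertexDist D ξ ν z) ≤ √(vertexDist D ξ ν z) :=
    mul_le_of_le_one_left (Real.sqrt_nonneg _) hc1
  have := norm_add_le (z - ξ) (l • v)
  linarith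

theorem derivs_littleO_of_hasAdmissibleLimit (h : IsBoundaryChart D ξ ν ρ r C B)
    (hf : DifferentiableOn ℂ f D) {L : OnePoint ℂ} (hL : HasAdmissibleLimit D f ξ ν L)
    (hα : 0 < α) :
    NormalSphericalDerivLittleO D f ξ ν α ∧ TangentialSphericalDerivLittleO D f ξ ν α := by
  have hr := h.pos
  have hC0 := h.nonneg
  -- The 4 is the product of the constants in `‖η - ν‖ ≤ 2 C ‖ζ - ξ‖` and `‖ζ - ξ‖ ≤ 2 ‖z - ξ‖`.
  obtain ⟨c, hc0, hc1, hC⟩ : ∃ c : ℝ, 0 < c ∧ c ≤ 1 ∧ 4 * C * (√α + 2) * c ≤ 1 / 8 := by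
    refine ⟨(1 + 32 * C * (√α + 2))⁻¹, by positivity, inv_le_one_of_one_le₀ ?_, ?_⟩
    · have : 0 ≤ 32 * C * (√α + 2) := by positivity
      linarith
    · rw [← div_eq_mul_inv, div_le_iff₀ (by positivity)]
      linarith
  have hC' : C * (√α + 2) * c ≤ 1 / 8 := by
    have : 0 ≤ C * (√α + 2) * c := by positivity
    linarith
  have hsmall : Tendsto (fun z => ‖z - ξ‖) (𝓝 ξ) (𝓝 0) := by
    have : Continuous fun z => ‖z - ξ‖ := by fun_prop
    simpa using this.tendsto ξ
  constructor <;> intro ε hε <;> rw [eventually_nhdsWithin_iff]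
  · filter_upwards [h.sphericalDeriv_le_of_hasAdmissibleLimit hf hL hα hc1 hC'
      (by positivity : 0 < ε * (c / 8)), hsmall.eventually (gt_mem_nhds one_pos)]
      with z hz hz1 hzα ζ η hζ hη
    have hd := vertexDist_pos_of_mem hα hzα
    have hd1 : vertexDist D ξ ν z ≤ 1 := (vertexDist_le_norm h.mem_frontier).trans hz1.le
    set d := vertexDist D ξ ν z
    have hdsq : d ≤ √d := Real.le_sqrt_of_sq_le (by nlinarith)
    -- At radius of order `d` the trivial bound `‖(η, ν)‖ ≤ 1` suffices; no closeness of `η` to `ν`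
    -- is needed.
    refine (hz hzα η (c / 8 * d) (by positivity) ?_ ?_).trans_eq ?_
    · rw [hη.1, mul_one]
      nlinarith
    · have : ‖inner ℂ ν η‖ ≤ 1 := by
        simpa [h.norm_eq, hη.1] using norm_inner_le_norm (𝕜 := ℂ) ν η
      refine (mul_le_of_le_one_right (by positivity) this).trans ?_
      nlinarith
    · field_simp
  · filter_upwards [h.sphericalDeriv_le_of_hasAdmissibleLimit hf hL hα hc1 hC'
      (by positivity : 0 < ε * c), hsmall.eventually (gt_mem_nhds (half_pos hr))]
      with z hz hz1 hzα ζ η hζ hη v hv hηv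
    have hd := vertexDist_pos_of_mem hα hzα
    have hxd : ‖z - ξ‖ ≤ √α * √(vertexDist D ξ ν z) := by
      rw [← Real.sqrt_mul hα.le]
      exact Real.le_sqrt_of_sq_le hzα.2.2.2.le
    set d := vertexDist D ξ ν z
    have hsd : 0 < √d := Real.sqrt_pos.2 hd
    have hζξ := norm_sub_le_of_isClosestBoundaryPoint h.mem_frontier hζ
    have hην := h.norm_normal_sub_le hζ.1 (mem_ball_iff_norm.2 (by linarith)) hη
    refine (hz hzα v (c * √d) (by positivity) ?_ ?_).trans_eq ?_
    · rw [hv, mul_one]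
    -- As `v` is orthogonal to `η`, its `ν`-part is only `O(√d)`, so a disc of radius `c √d` extends
    -- by `O(c d)` in the complex normal direction.
    · have h1 : ‖inner ℂ ν v‖ ≤ ‖η - ν‖ := by
        have h2 : inner ℂ ν v = -inner ℂ (η - ν) v := by rw [inner_sub_left, hηv]; ring
        rw [h2, norm_neg]
        exact (norm_inner_le_norm _ _).trans_eq (by rw [hv, mul_one])
      calc c * √d * ‖inner ℂ ν v‖ ≤ c * √d * (2 * C * (2 * (√α * √d))) := by
            gcongr
            refine h1.trans (hην.trans ?_)
            gcongr
            linarith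
        _ = 4 * C * √α * c * (√d * √d) := by ring
        _ = 4 * C * √α * c * d := by rw [Real.mul_self_sqrt hd.le]
        _ ≤ 4 * C * (√α + 2) * c * d := by gcongr; linarith
        _ ≤ 1 / 8 * d := by gcongr
        _ = d / 8 := by ring
    · field_simp

/-- Bound of the spherical derivative in a direction that is complex tangential at `ξ` up to
`O(δ)`. -/
theorem sphericalDeriv_le_of_isClosestBoundaryPoint (h : IsBoundaryChart D ξ ν ρ r C B)
    {y u ζ η : EuclideanSpace ℂ (Fin n)} {d ε s : ℝ}
    (hζ : IsClosestBoundaryPoint D y ζ) (hη : IsUnitOutwardNormal D ζ η)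
    (hy : 2 * ‖y - ξ‖ < r) (hε : 0 ≤ ε) (hd : 0 < d) (hdy : d ≤ vertexDist D ξ ν y)
    (hN : sphericalDeriv f y η ≤ ε * (1 / vertexDist D ξ ν y))
    (hT : ∀ v, ‖v‖ = 1 → inner ℂ η v = 0 →
      sphericalDeriv f y v ≤ ε * (1 / √(vertexDist D ξ ν y)))
    (hyu : ‖y - ξ‖ ≤ s * √d) (hu : ‖u‖ ≤ 2 * s * √d) (hνu : ‖inner ℂ ν u‖ ≤ s * d) (hs : 0 ≤ s) :
    sphericalDeriv f y u ≤ ε * (5 * s + 8 * C * s ^ 2) := by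
  have hC0 := h.nonneg
  have hsd : 0 < √d := Real.sqrt_pos.2 hd
  have hζξ := norm_sub_le_of_isClosestBoundaryPoint h.mem_frontier hζ
  have hην := h.norm_normal_sub_le hζ.1 (mem_ball_iff_norm.2 (by linarith)) hη
  -- Split `u` into `k • η` and a vector tangential at `ζ`. Here `k = O(d)` meets the bound `ε / d`,
  -- and the tangential part, `O(√d)`, meets `ε / √d`.
  set k : ℂ := inner ℂ η u with hk
  have hkd : ‖k‖ ≤ (s + 8 * C * s ^ 2) * d := by
    have h1 : k = inner ℂ ν u + inner ℂ (η - ν) u := by rw [← inner_add_left]; simp [hk]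
    have h2 := norm_inner_le_norm (𝕜 := ℂ) (η - ν) u
    have h3 : ‖η - ν‖ * ‖u‖ ≤ 8 * C * s ^ 2 * d := by
      calc ‖η - ν‖ * ‖u‖ ≤ 2 * C * (2 * (s * √d)) * (2 * s * √d) := by
            gcongr
            refine hην.trans ?_
            gcongr
            linarith
        _ = 8 * C * s ^ 2 * (√d * √d) := by ring
        _ = 8 * C * s ^ 2 * d := by rw [Real.mul_self_sqrt hd.le]
    have := norm_add_le (inner ℂ ν u) (inner ℂ (η - ν) u)
    rw [h1]
    linarith
  have hku : ‖k‖ ≤ ‖u‖ := by simpa [hη.1] using norm_inner_le_norm (𝕜 := ℂ) η u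
  obtain ⟨w, hw⟩ : ∃ w, w = u - k • η := ⟨_, rfl⟩
  have huw : u = k • η + w := by rw [hw]; abel
  have hηw : inner ℂ η w = 0 := by
    rw [hw, inner_sub_right, inner_smul_right, inner_self_eq_norm_sq_to_K, hη.1]
    simp [hk]
  have hwn : ‖w‖ ≤ 4 * s * √d := by
    rw [hw]
    refine (norm_sub_le _ _).trans ?_
    rw [norm_smul, hη.1]
    linarith
  have hNd : sphericalDeriv f y η ≤ ε * (1 / d) := hN.trans (by gcongr)
  have hnorm : sphericalDeriv f y (k • η) ≤ ε * (s + 8 * C * s ^ 2) := by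
    rw [sphericalDeriv_smul]
    calc ‖k‖ * sphericalDeriv f y η ≤ (s + 8 * C * s ^ 2) * d * (ε * (1 / d)) :=
          mul_le_mul hkd hNd sphericalDeriv_nonneg (by positivity)
      _ = ε * (s + 8 * C * s ^ 2) := by field_simp
  have htan : sphericalDeriv f y w ≤ ε * (4 * s) := by
    rcases eq_or_ne w 0 with h0 | h0
    · rw [h0]
      simp only [sphericalDeriv, map_zero, norm_zero, zero_div]
      positivity
    · have hn : ‖w‖ ≠ 0 := norm_ne_zero_iff.2 h0
      have hwv : w = (‖w‖ : ℂ) • ((‖w‖⁻¹ : ℝ) : ℂ) • w := by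
        rw [smul_smul, ← Complex.ofReal_mul, mul_inv_cancel₀ hn, Complex.ofReal_one, one_smul]
      have hT' := hT (((‖w‖⁻¹ : ℝ) : ℂ) • w) (by rw [norm_smul]; simp [hn])
        (by rw [inner_smul_right, hηw, mul_zero])
      have hTd : sphericalDeriv f y (((‖w‖⁻¹ : ℝ) : ℂ) • w) ≤ ε * (1 / √d) :=
        hT'.trans (by gcongr)
      rw [hwv, sphericalDeriv_smul, Complex.norm_real, norm_norm]
      calc _ ≤ 4 * s * √d * (ε * (1 / √d)) :=
            mul_le_mul hwn hTd sphericalDeriv_nonneg (by positivity)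
        _ = ε * (4 * s) := by field_simp
  rw [huw]
  refine sphericalDeriv_add_le.trans ?_
  linarith

/-- Under the derivative conditions, the values of `f` in an admissible domain are close to its
values on the normal. -/
theorem tendsto_stereo_sub (h : IsBoundaryChart D ξ ν ρ r C B)
    (hf : DifferentiableOn ℂ f D) (hα : 0 < α)
    (hN : NormalSphericalDerivLittleO D f ξ ν (8 * (1 + α)))
    (hT : TangentialSphericalDerivLittleO D f ξ ν (8 * (1 + α))) :
    Tendsto (fun z => stereo (f z) - stereo (f (ξ + (inner ℂ ν (z - ξ)).re • ν)))
      (𝓝[admissibleDomain D ξ ν α] ξ) (𝓝 0) := by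
  have hr := h.pos
  have hC0 := h.nonneg
  -- The depth on the segment is only known to be at least `d / 8`: so `‖x‖² < α d = 8 α (d/8)`, and
  -- the complex normal part of `u` is at most `2 (1 + α) d = 16 (1 + α) (d/8)`.
  obtain ⟨s, hs, hsα, hsα'⟩ : ∃ s : ℝ, 0 < s ∧ 16 * (1 + α) ≤ s ∧ √(8 * α) ≤ s :=
    ⟨16 * (1 + α) + √(8 * α), by positivity, by linarith [Real.sqrt_nonneg (8 * α)],
      by linarith⟩
  rw [Metric.tendsto_nhds]
  intro ε₀ hε₀
  obtain ⟨ε, hε, hεs⟩ : ∃ ε : ℝ, 0 < ε ∧ 3 * (ε * (5 * s + 8 * C * s ^ 2)) < ε₀ := by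
    have hK : 0 < 5 * s + 8 * C * s ^ 2 := by positivity
    refine ⟨ε₀ / (4 * (5 * s + 8 * C * s ^ 2)), by positivity, ?_⟩
    have : 3 * (ε₀ / (4 * (5 * s + 8 * C * s ^ 2)) * (5 * s + 8 * C * s ^ 2)) = 3 / 4 * ε₀ := by
      field_simp
    linarith
  obtain ⟨δ, hδ, hball⟩ := Metric.eventually_nhds_iff_ball.1
    ((eventually_nhdsWithin_iff.1 (hN ε hε)).and (eventually_nhdsWithin_iff.1 (hT ε hε)))
  rw [eventually_nhdsWithin_iff]
  filter_upwards [h.segment_mem_admissibleDomain hα, Metric.ball_mem_nhds ξ hδ,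
    Metric.ball_mem_nhds ξ (half_pos hr)] with z hseg hzδ hzr hz
  have hd := vertexDist_pos_of_mem hα hz
  have hzα := hz.2.2
  specialize hseg hz
  set d := vertexDist D ξ ν z
  set x := z - ξ with hx
  set a := (inner ℂ ν x).re with ha
  set u := x - a • ν with hu
  have hax : |a| ≤ ‖x‖ := by simpa [h.norm_eq] using abs_re_inner_le ν x
  have haN : |a| ≤ ‖inner ℂ ν x‖ := Complex.abs_re_le_norm _
  have hxs : ‖x‖ ≤ s * √(d / 8) := by
    have h1 : ‖x‖ ≤ √(α * d) := Real.le_sqrt_of_sq_le hzα.2.le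
    have h2 : α * d = 8 * α * (d / 8) := by ring
    rw [h2, Real.sqrt_mul (by positivity)] at h1
    exact h1.trans (by gcongr)
  have hus : ‖u‖ ≤ 2 * s * √(d / 8) := by
    refine (norm_sub_le _ _).trans ?_
    rw [norm_smul, h.norm_eq, Real.norm_eq_abs]
    linarith
  have hνu : ‖inner ℂ ν u‖ ≤ s * (d / 8) := by
    rw [hu, inner_sub_right]
    refine (norm_sub_le _ _).trans ?_
    have h1 : ‖inner ℂ ν (a • ν)‖ ≤ |a| := by
      refine (norm_inner_le_norm _ _).trans ?_
      rw [norm_smul, h.norm_eq, Real.norm_eq_abs]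
      simp
    have h2 : 16 * (1 + α) * (d / 8) ≤ s * (d / 8) := by gcongr
    linarith [hzα.1]
  have hpath : ∀ t ∈ Set.Icc (0 : ℝ) 1, DifferentiableAt ℂ f (ξ + a • ν + t • u) ∧
      sphericalDeriv f (ξ + a • ν + t • u) u ≤ ε * (5 * s + 8 * C * s ^ 2) := by
    intro t ht
    obtain ⟨m1, m2, m3⟩ := hseg t ht (ξ + a • ν + t • u) (by
      rw [hu, sub_smul, one_smul, smul_sub]
      abel)
    -- The derivative conditions speak of all closest points and normals, so existence of both is
    -- needed to apply them.
    obtain ⟨ζ, hζ⟩ := exists_isClosestBoundaryPoint h.mem_frontier (ξ + a • ν + t • u)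
    have hyr : 2 * ‖ξ + a • ν + t • u - ξ‖ < r := by
      have := mem_ball_iff_norm.1 hzr
      linarith
    have hζr : ζ ∈ Metric.ball ξ r := mem_ball_iff_norm.2
      ((norm_sub_le_of_isClosestBoundaryPoint h.mem_frontier hζ).trans_lt hyr)
    obtain ⟨η, hη⟩ := (h.defining.of_mem hζr).exists_isUnitOutwardNormal
    have hb := hball _ (mem_ball_iff_norm.2 (m3.trans_lt (mem_ball_iff_norm.1 hzδ)))
    exact ⟨hf.differentiableAt (h.isOpen.mem_nhds m1.1),
      h.sphericalDeriv_le_of_isClosestBoundaryPoint hζ hη hyr hε.le (by positivity) m2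
        (hb.1 m1 ζ η hζ hη) (hb.2 m1 ζ η hζ hη) (m3.trans hxs) hus hνu hs.le⟩
  have hder : ∀ t ∈ Set.Icc (0 : ℝ) 1, HasDerivWithinAt (fun t : ℝ => f (ξ + a • ν + t • u))
      (fderiv ℂ f (ξ + a • ν + t • u) u) (Set.Icc 0 1) t := fun t ht => by
    have hline : HasDerivAt (fun t : ℝ => ξ + a • ν + t • u) u t := by
      simpa using ((hasDerivAt_id t).smul_const u).const_add (ξ + a • ν)
    exact (((hpath t ht).1.hasFDerivAt.restrictScalars ℝ).comp_hasDerivAt t hline).hasDerivWithinAt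
  have := norm_stereo_sub_le hder fun t ht => (hpath t ht).2
  have h1 : ξ + a • ν + (1 : ℝ) • u = z := by rw [hu, hx, one_smul]; abel
  simp only [h1, zero_smul, add_zero] at this
  rw [dist_zero_right]
  exact this.trans_lt hεs

end IsBoundaryChart

/-- The parameter `-Re (z - ξ, ν)` on the normal is positive in an admissible domain and tends to
zero. -/
theorem tendsto_normal_of_hasNormalLimit {L : OnePoint ℂ} (hL : HasNormalLimit f ξ ν L) :
    Tendsto (fun z => (f (ξ + (inner ℂ ν (z - ξ)).re • ν) : OnePoint ℂ))
      (𝓝[admissibleDomain D ξ ν α] ξ) (𝓝 L) := by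
  have h1 : Tendsto (fun z => -(inner ℂ ν (z - ξ)).re) (𝓝[admissibleDomain D ξ ν α] ξ)
      (𝓝[>] 0) := by
    refine tendsto_nhdsWithin_iff.2 ⟨?_, ?_⟩
    · have : Continuous fun z => -(inner ℂ ν (z - ξ)).re :=
        ((reInner ν).continuous.comp (continuous_sub_right ξ)).neg
      simpa using (this.tendsto ξ).mono_left nhdsWithin_le_nhds
    · filter_upwards [self_mem_nhdsWithin] with z hz
      exact neg_pos.2 hz.2.1
  refine (Tendsto.comp hL h1).congr fun z => ?_
  simp only [Function.comp_apply, neg_smul, sub_neg_eq_add]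

end AdmissibleLimit

theorem theorem3 {n : ℕ} (hn : 1 < n) (D : Set (EuclideanSpace ℂ (Fin n)))
    (hD_open : IsOpen D) (hD_conn : IsConnected D) (hD_C2 : HasC2Boundary D)
    (f : EuclideanSpace ℂ (Fin n) → ℂ) (hf : DifferentiableOn ℂ f D)
    (ξ : EuclideanSpace ℂ (Fin n)) (hξ : ξ ∈ frontier D)
    (ν : EuclideanSpace ℂ (Fin n)) (hν : IsUnitOutwardNormal D ξ ν)
    (hlim : ∃ L : OnePoint ℂ, HasNormalLimit f ξ ν L) :
    (∃ L : OnePoint ℂ, HasAdmissibleLimit D f ξ ν L) ↔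
      ∀ α : ℝ, 0 < α →
        NormalSphericalDerivLittleO D f ξ ν α ∧ TangentialSphericalDerivLittleO D f ξ ν α := by
  obtain ⟨ρ, r, C, B, h⟩ := hν.exists_isBoundaryChart hD_open hξ
  constructor
  · rintro ⟨L, hL⟩ α hα
    exact h.derivs_littleO_of_hasAdmissibleLimit hf hL hα
  · intro H
    obtain ⟨L, hL⟩ := hlim
    refine ⟨L, fun α hα => ?_⟩
    -- The segments from the domain of aperture `α` to the normal run in the domain of aperture `8
    -- (1 + α)`.
    obtain ⟨hN, hT⟩ := H (8 * (1 + α)) (by positivity)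
    have h1 := tendsto_coe_iff_tendsto_stereo.1 (tendsto_normal_of_hasNormalLimit (D := D)
      (α := α) hL)
    have h2 := (h.tendsto_stereo_sub hf hα hN hT).add h1
    rw [zero_add] at h2
    exact tendsto_coe_iff_tendsto_stereo.2 (by simpa using h2)
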